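/- Let $V:\mathbb R\to\mathbb R$ be a smooth even potential such that, for some constants $k\ge 2$ and $a_k>0$ and all $x\in\mathbb R$, $\lim_{\lambda\to+\infty}\lambda^{-k}V(\lambda x)=a_k|x|^k$ and $\lim_{\lambda\to+\infty}\lambda^{1-k}V'(\lambda x)=k\,a_k|x|^{k-1}\operatorname{sign}(x)$, and such that for every $q\in\mathbb R$ there is $m\ge 2$ with $V^{(m)}(q)\neq 0$. Let $\tau\in\mathbb R$, $T>0$, $\gamma>0$. Let $\mu_{\tau,T}$ be the product probability measure on configurations $\omega=(r_x,p_x)_{x\in\mathbb Z}\in(\mathbb R\times\mathbb R)^{\mathbb Z}$ under which all the coordinates are independent, each $r_x$ has density proportional to $e^{-(V(r)-\tau r)/T}$ and each $p_x$ is centered Gaussian with variance $T$. A local function is a measurable $\mu_{\tau,T}$-square-integrable real function of finitely many coordinates. With the shifts $(\theta_x\omega)_z=\omega_{x+z}$, $(\theta_xg)(\omega)=g(\theta_x\omega)$, let $\mathcal H$ be the Hilbert space obtained by completing the space of local functions with respect to the semi-inner product $$\ll f,g\gg=\sum_{x\in\mathbb Z}\{\mu_{\tau,T}(f\,\theta_xg)-\mu_{\tau,T}(f)\mu_{\tau,T}(g)\},$$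 and let $\mathcal H^a\subset\mathcal H$ be the closed subspace of functions antisymmetric in the momenta, that is, the closure of the set of (classes of) local functions with $f(r,-p)=-f(r,p)$. Let $C_0^1$ be the set of compactly supported $C^1$ functions of finitely many coordinates, and for $f\in C_0^1$ let $$\mathfrak Af=\sum_{x\in\mathbb Z}\big[(p_x-p_{x-1})\partial_{r_x}f+(V'(r_{x+1})-V'(r_x))\partial_{p_x}f\big],\qquad \mathfrak Sf(\omega)=\sum_{x\in\mathbb Z}[f(\omega^x)-f(\omega)],$$ where $\omega^x$ is obtained from $\omega$ by changing $p_x$ into $-p_x$. Assume that $\mathfrak L$ is the generator of a strongly continuous semigroup on $\mathcal H$, that $C_0^1\subset\mathcal D(\mathfrak L)$ with $\mathfrak L=\mathfrak A+\gamma\mathfrak S$ on $C_0^1$, and that $C_0^1$ is dense in $\mathcal D(\mathfrak L)$ for the graph norm. Then for every $\lambda>0$ the operator $\lambda-\mathfrak L:\mathcal D(\mathfrak L)\to\mathcal H$ is bijective; for all $f,g\in\mathcal H^a$ the limit $$\sigma(f,g)=\lim_{\lambda\downarrow0}\ll f,(\lambda-\mathfrak L)^{-1}g\gg$$ exists; and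 $\sigma(f,g)=\sigma(g,f)$. -/

import Mathlib

open MeasureTheory ProbabilityTheory Filter Topology
open scoped NNReal

noncomputable section

namespace FlipChain

/-! ### Assumptions on the potential -/

/-- The interaction potential `V` is smooth, even, asymptotically homogeneous of some degree
`k ≥ 2` (together with its derivative), and has at every point a non-vanishing derivative of
some order `m ≥ 2`. -/
structure IsPotential (V : ℝ → ℝ) : Prop where
  smooth : ContDiff ℝ (⊤ : ℕ∞) V
  even : ∀ x, V (-x) = V x
  growth : ∃ k a : ℝ, 2 ≤ k ∧ 0 < a ∧
    (∀ x : ℝ, Tendsto (fun s : ℝ => s ^ (-k) * V (s * x)) atTop (𝓝 (a * |x| ^ k))) ∧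
    (∀ x : ℝ, Tendsto (fun s : ℝ => s ^ (1 - k) * deriv V (s * x)) atTop
      (𝓝 (k * a * |x| ^ (k - 1) * Real.sign x)))
  nondegenerate : ∀ q : ℝ, ∃ m : ℕ, 2 ≤ m ∧ iteratedDeriv m V q ≠ 0

/-! ### Configurations and the Gibbs measure -/

/-- Configurations `ω = (r_x, p_x)_{x ∈ ℤ}` of the infinite chain; `(ω x).1 = r_x` is the
interparticle distance and `(ω x).2 = p_x` the momentum. (Only functions of finitely many
coordinates and their classes modulo `μ_{τ,T}` are used below, so nothing changes if the
configurations are restricted to the set of full measure of those with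
`∑ x, exp (-α |x|) (r_x ^ 2 + p_x ^ 2) < ∞` for all `α > 0`.) -/
abbrev Config : Type := ℤ → ℝ × ℝ

/-- The spatial shift `(θ_x ω)_z = ω_{x+z}`. -/
def shift (x : ℤ) (ω : Config) : Config := fun z => ω (x + z)

/-- The configuration `ω^x`, with the sign of the momentum of particle `x` flipped. -/
def flipAt (x : ℤ) (ω : Config) : Config := Function.update ω x ((ω x).1, -(ω x).2)

/-- The configuration `(r, -p)`, with the sign of all the momenta flipped. -/
def reverseMomenta (ω : Config) : Config := fun x => ((ω x).1, -(ω x).2)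

/-- One-site Gibbs measure at tension `τ` and temperature `T`: `r` has density proportional to
`exp (-(V r - τ r) / T)`, and `p` is an independent centered Gaussian of variance `T`. -/
def siteMeasure (V : ℝ → ℝ) (τ T : ℝ) : Measure (ℝ × ℝ) :=
  (volume.tilted fun r => -(V r - τ * r) / T).prod (gaussianReal 0 T.toNNReal)

/-- The infinite volume Gibbs measure `μ_{τ,T}`. -/
def gibbs (V : ℝ → ℝ) (τ T : ℝ) : Measure Config :=
  Measure.infinitePi fun _ : ℤ => siteMeasure V τ T

/-! ### Local functions and the semi-inner product -/

/-- Local functions: (measurable) functions of finitely many coordinates, square integrable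
with respect to `μ_{τ,T}`. -/
def localSubmodule (V : ℝ → ℝ) (τ T : ℝ) : Submodule ℝ (Config → ℝ) where
  carrier := {f | Measurable f ∧ (∃ Λ : Finset ℤ, DependsOn f (Λ : Set ℤ)) ∧
    MemLp f 2 (gibbs V τ T)}
  zero_mem' := ⟨measurable_const, ⟨∅, fun _ _ _ => rfl⟩, MemLp.zero⟩
  add_mem' := by
    rintro f g ⟨hf, ⟨Λ, hΛ⟩, hf2⟩ ⟨hg, ⟨Λ', hΛ'⟩, hg2⟩
    refine ⟨hf.add hg, ⟨Λ ∪ Λ', fun ω ω' h => ?_⟩, hf2.add hg2⟩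
    have h1 := hΛ (fun i hi => h i (by simp_all) : ∀ i ∈ (Λ : Set ℤ), ω i = ω' i)
    have h2 := hΛ' (fun i hi => h i (by simp_all) : ∀ i ∈ (Λ' : Set ℤ), ω i = ω' i)
    simp [h1, h2]
  smul_mem' := by
    rintro c f ⟨hf, ⟨Λ, hΛ⟩, hf2⟩
    refine ⟨hf.const_smul c, ⟨Λ, fun ω ω' h => ?_⟩, hf2.const_smul c⟩
    simp [hΛ h]

/-- The space of local functions, to be equipped with the semi-inner product `≪·,·≫`. -/
def LocalFun (V : ℝ → ℝ) (τ T : ℝ) : Type := localSubmodule V τ T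

instance (V : ℝ → ℝ) (τ T : ℝ) : AddCommGroup (LocalFun V τ T) :=
  inferInstanceAs (AddCommGroup (localSubmodule V τ T))

instance (V : ℝ → ℝ) (τ T : ℝ) : Module ℝ (LocalFun V τ T) :=
  inferInstanceAs (Module ℝ (localSubmodule V τ T))

/-- The function on configurations underlying a local function. -/
def LocalFun.toFun {V : ℝ → ℝ} {τ T : ℝ} (f : LocalFun V τ T) : Config → ℝ :=
  Subtype.val (p := fun f => f ∈ localSubmodule V τ T) f

instance (V : ℝ → ℝ) (τ T : ℝ) : CoeFun (LocalFun V τ T) (fun _ => Config → ℝ) :=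
  ⟨LocalFun.toFun⟩

/-- The space-correlation `μ(f θ_x g) - μ(f) μ(g)`. -/
def corr (V : ℝ → ℝ) (τ T : ℝ) (f g : Config → ℝ) (x : ℤ) : ℝ :=
  (∫ ω, f ω * g (shift x ω) ∂gibbs V τ T) -
    (∫ ω, f ω ∂gibbs V τ T) * ∫ ω, g ω ∂gibbs V τ T

/-- The semi-inner product `≪f, g≫ = ∑_x {μ(f θ_x g) - μ(f) μ(g)}`. For local functions only
finitely many terms are nonzero. -/
def semiInner (V : ℝ → ℝ) (τ T : ℝ) (f g : Config → ℝ) : ℝ := ∑' x : ℤ, corr V τ T f g x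

/-! #### `≪·,·≫` is symmetric, bilinear and nonnegative -/

section Aux

variable {V : ℝ → ℝ} {τ T : ℝ}

lemma LocalFun.measurable (f : LocalFun V τ T) : Measurable (f : Config → ℝ) := f.2.1

lemma LocalFun.memLp (f : LocalFun V τ T) : MemLp (f : Config → ℝ) 2 (gibbs V τ T) := f.2.2.2

lemma LocalFun.add_apply (f g : LocalFun V τ T) :
    ((f + g : LocalFun V τ T) : Config → ℝ) = (f : Config → ℝ) + (g : Config → ℝ) := rfl

lemma LocalFun.smul_apply (c : ℝ) (f : LocalFun V τ T) :
    ((c • f : LocalFun V τ T) : Config → ℝ) = c • (f : Config → ℝ) := rfl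

lemma measurable_shift (x : ℤ) : Measurable (shift x) :=
  measurable_pi_lambda _ fun z => measurable_pi_apply (x + z)

lemma gibbs_eq_zero (h : ¬ IsProbabilityMeasure (siteMeasure V τ T)) : gibbs V τ T = 0 := by
  simp [gibbs, Measure.infinitePi, h]

lemma corr_eq_zero_of_not (h : ¬ IsProbabilityMeasure (siteMeasure V τ T))
    (f g : Config → ℝ) : corr V τ T f g = 0 := by
  funext x
  simp [corr, gibbs_eq_zero h]

lemma measurePreserving_shift [IsProbabilityMeasure (siteMeasure V τ T)] (x : ℤ) :
    MeasurePreserving (shift x) (gibbs V τ T) (gibbs V τ T) :=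
  ⟨measurable_shift x,
    Measure.map_infinitePi_infinitePi_of_inj (P := fun _ : ℤ => siteMeasure V τ T)
      (f := fun z => x + z) (add_right_injective x)⟩

instance [IsProbabilityMeasure (siteMeasure V τ T)] : IsProbabilityMeasure (gibbs V τ T) := by
  unfold gibbs; infer_instance

lemma memLp_shift [IsProbabilityMeasure (siteMeasure V τ T)] (g : LocalFun V τ T) (x : ℤ) :
    MemLp (fun ω => g (shift x ω)) 2 (gibbs V τ T) :=
  g.memLp.comp_measurePreserving (measurePreserving_shift x)

lemma integral_comp_shift [IsProbabilityMeasure (siteMeasure V τ T)] (F : Config → ℝ)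
    (hF : Measurable F) (x : ℤ) :
    ∫ ω, F (shift x ω) ∂gibbs V τ T = ∫ ω, F ω ∂gibbs V τ T := by
  have h := measurePreserving_shift (V := V) (τ := τ) (T := T) x
  conv_rhs => rw [← h.map_eq]
  rw [integral_map h.measurable.aemeasurable hF.aestronglyMeasurable]

lemma corr_eq_cov [IsProbabilityMeasure (siteMeasure V τ T)] (f g : LocalFun V τ T) (x : ℤ) :
    corr V τ T f g x = cov[f, fun ω => g (shift x ω); gibbs V τ T] := by
  rw [covariance_eq_sub f.memLp (memLp_shift g x), integral_comp_shift _ g.measurable]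
  rfl

lemma shift_shift (x y : ℤ) (ω : Config) : shift x (shift y ω) = shift (y + x) ω := by
  funext z; simp [shift, add_assoc]

lemma cov_shift_shift [IsProbabilityMeasure (siteMeasure V τ T)] (f g : LocalFun V τ T)
    (a b : ℤ) :
    cov[fun ω => f (shift a ω), fun ω => g (shift b ω); gibbs V τ T] =
      corr V τ T f g (b - a) := by
  rw [covariance_eq_sub (memLp_shift f a) (memLp_shift g b), integral_comp_shift _ f.measurable,
    integral_comp_shift _ g.measurable, corr]
  congr 1
  rw [← integral_comp_shift (fun ω => f ω * g (shift (b - a) ω))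
    (f.measurable.mul (g.measurable.comp (measurable_shift _))) a]
  simp [shift_shift]

lemma corr_comm (f g : LocalFun V τ T) (x : ℤ) :
    corr V τ T f g x = corr V τ T g f (-x) := by
  by_cases hP : IsProbabilityMeasure (siteMeasure V τ T)
  · have h := cov_shift_shift g f x 0
    rw [zero_sub] at h
    have h0 : (fun ω : Config => f (shift 0 ω)) = f := by
      funext ω
      exact congrArg f (funext fun z => by simp [shift])
    rw [← h, covariance_comm, corr_eq_cov, h0]
  · simp [corr_eq_zero_of_not hP]

lemma exists_corr_eq_zero (f g : LocalFun V τ T) :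
    ∃ R : ℕ, ∀ x : ℤ, (R : ℤ) < |x| → corr V τ T f g x = 0 := by
  by_cases hP : IsProbabilityMeasure (siteMeasure V τ T)
  swap
  · exact ⟨0, fun x _ => by simp [corr_eq_zero_of_not hP]⟩
  obtain ⟨Λ, hf⟩ := f.2.2.1
  obtain ⟨Λ', hg⟩ := g.2.2.1
  refine ⟨∑ i ∈ Λ, i.natAbs + ∑ i ∈ Λ', i.natAbs, fun x hx => ?_⟩
  set Λx : Finset ℤ := Λ'.image fun z => x + z with hΛx
  have hdisj : Disjoint Λ Λx := by
    rw [Finset.disjoint_left]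
    intro i hi hi'
    obtain ⟨j, hj, rfl⟩ := Finset.mem_image.1 hi'
    have h1 := Finset.single_le_sum (f := fun i : ℤ => i.natAbs) (fun _ _ => Nat.zero_le _) hi
    have h2 := Finset.single_le_sum (f := fun i : ℤ => i.natAbs) (fun _ _ => Nat.zero_le _) hj
    rw [Int.abs_eq_natAbs] at hx
    omega
  have hgx : DependsOn (fun ω => g (shift x ω)) (Λx : Set ℤ) := by
    intro ω ω' h
    refine hg fun i hi => h (x + i) ?_
    simpa [hΛx] using hi
  have hind : iIndepFun (fun (i : ℤ) (ω : Config) => ω i) (gibbs V τ T) :=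
    iIndepFun_infinitePi (P := fun _ : ℤ => siteMeasure V τ T) (X := fun _ ω => ω)
      (fun _ => measurable_id)
  have hind2 := hind.indepFun_finset Λ Λx hdisj (fun i => measurable_pi_apply i)
  have key : ∀ (F : Config → ℝ) (S : Finset ℤ), Measurable F → DependsOn F (S : Set ℤ) →
      ∃ G : (S → ℝ × ℝ) → ℝ, Measurable G ∧ F = G ∘ fun ω (i : S) => ω i := by
    intro F S hF hS
    refine ⟨fun η => F fun i => if h : i ∈ S then η ⟨i, h⟩ else 0, hF.comp ?_, ?_⟩
    · refine measurable_pi_lambda _ fun i => ?_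
      by_cases h : i ∈ S
      · simpa [h] using measurable_pi_apply _
      · simp [h]
    · funext ω
      refine hS fun i hi => ?_
      have : i ∈ S := hi
      simp [this]
  obtain ⟨F, hF, hF'⟩ := key f Λ f.measurable hf
  obtain ⟨G, hG, hG'⟩ := key _ Λx (g.measurable.comp (measurable_shift x)) hgx
  have hfg : IndepFun (f : Config → ℝ) (fun ω => g (shift x ω)) (gibbs V τ T) := by
    have h := hind2.comp hF hG
    rw [← hF', ← hG'] at h
    exact h
  rw [corr_eq_cov]
  exact hfg.covariance_eq_zero f.memLp (memLp_shift g x)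

lemma summable_corr (f g : LocalFun V τ T) : Summable (corr V τ T f g) := by
  obtain ⟨R, hR⟩ := exists_corr_eq_zero f g
  refine summable_of_ne_finset_zero (s := Finset.Icc (-(R : ℤ)) R) fun x hx => hR x ?_
  rw [Finset.mem_Icc, ← abs_le] at hx
  exact not_le.1 hx

lemma semiInner_comm (f g : LocalFun V τ T) : semiInner V τ T f g = semiInner V τ T g f := by
  unfold semiInner
  rw [← (Equiv.neg ℤ).tsum_eq]
  exact tsum_congr fun x => by simp [corr_comm f g]

lemma semiInner_add_left (f f' g : LocalFun V τ T) :
    semiInner V τ T (f + f' : LocalFun V τ T) g = semiInner V τ T f g + semiInner V τ T f' g := by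
  unfold semiInner
  rw [← (summable_corr f g).tsum_add (summable_corr f' g)]
  refine tsum_congr fun x => ?_
  by_cases hP : IsProbabilityMeasure (siteMeasure V τ T)
  · rw [corr_eq_cov, corr_eq_cov, corr_eq_cov, LocalFun.add_apply,
      covariance_add_left f.memLp f'.memLp (memLp_shift g x)]
  · simp [corr_eq_zero_of_not hP]

lemma semiInner_smul_left (c : ℝ) (f g : LocalFun V τ T) :
    semiInner V τ T (c • f : LocalFun V τ T) g = c * semiInner V τ T f g := by
  unfold semiInner
  rw [← tsum_mul_left]
  refine tsum_congr fun x => ?_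
  by_cases hP : IsProbabilityMeasure (siteMeasure V τ T)
  · rw [corr_eq_cov, corr_eq_cov, LocalFun.smul_apply, covariance_smul_left]
  · simp [corr_eq_zero_of_not hP]

lemma tsum_nonneg_of_forms (C : ℤ → ℝ) (R : ℕ) (hR : ∀ x : ℤ, (R : ℤ) < |x| → C x = 0)
    (hC : ∀ n : ℕ, 0 ≤ ∑ a ∈ Finset.range n, ∑ b ∈ Finset.range n, C ((b : ℤ) - a)) :
    0 ≤ ∑' x, C x := by
  have hsum : ∀ S : Finset ℤ, Finset.Icc (-(R : ℤ)) R ⊆ S → ∑' x, C x = ∑ x ∈ S, C x := by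
    intro S hS
    refine tsum_eq_sum fun x hx => hR x ?_
    by_contra h
    exact hx (hS (Finset.mem_Icc.2 (abs_le.1 (not_lt.1 h))))
  have habs : Summable fun x => |C x| := by
    refine summable_of_ne_finset_zero (s := Finset.Icc (-(R : ℤ)) R) fun x hx => ?_
    rw [Finset.mem_Icc, ← abs_le] at hx
    simp [hR x (not_le.1 hx)]
  have himg : ∀ n a : ℕ, ∑ b ∈ Finset.range n, C ((b : ℤ) - a) =
      ∑ x ∈ (Finset.range n).image (fun b : ℕ => (b : ℤ) - a), C x := by
    intro n a
    rw [Finset.sum_image]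
    intro b _ b' _ h
    simpa using h
  have hD : ∀ n a : ℕ, ∑ b ∈ Finset.range n, C ((b : ℤ) - a) ≤ ∑' x, |C x| := by
    intro n a
    rw [himg]
    exact (Finset.sum_le_sum fun x _ => le_abs_self (C x)).trans
      (habs.sum_le_tsum _ fun x _ => abs_nonneg _)
  have hI : ∀ m a : ℕ, a < m →
      ∑ b ∈ Finset.range (R + m + R), C ((b : ℤ) - (R + a : ℕ)) = ∑' x, C x := by
    intro m a ha
    rw [himg]
    refine (hsum _ fun x hx => ?_).symm
    rw [Finset.mem_Icc] at hx
    refine Finset.mem_image.2 ⟨(x + (R + a : ℕ)).toNat, ?_, ?_⟩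
    · rw [Finset.mem_range]; omega
    · omega
  have hbound : ∀ m : ℕ, 0 ≤ m * (∑' x, C x) + 2 * R * ∑' x, |C x| := by
    intro m
    refine (hC (R + m + R)).trans ?_
    rw [Finset.sum_range_add, Finset.sum_range_add]
    have h1 := Finset.sum_le_card_nsmul (Finset.range R) _ _ fun a _ => hD (R + m + R) a
    have h2 := Finset.sum_le_card_nsmul (Finset.range R) _ _
      fun a _ => hD (R + m + R) (R + m + a)
    have h3 : ∑ a ∈ Finset.range m,
        ∑ b ∈ Finset.range (R + m + R), C ((b : ℤ) - (R + a : ℕ)) = m * ∑' x, C x := by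
      rw [Finset.sum_congr rfl fun a ha => hI m a (Finset.mem_range.1 ha)]
      simp
    rw [h3]
    simp only [Finset.card_range, nsmul_eq_mul] at h1 h2
    linarith
  by_contra hneg
  push Not at hneg
  obtain ⟨m, hm⟩ := exists_nat_gt ((2 * R * ∑' x, |C x|) / (-∑' x, C x))
  rw [div_lt_iff₀ (by linarith)] at hm
  have := hbound m
  linarith

lemma semiInner_self_nonneg (f : LocalFun V τ T) : 0 ≤ semiInner V τ T f f := by
  obtain ⟨R, hR⟩ := exists_corr_eq_zero f f
  refine tsum_nonneg_of_forms _ R hR fun n => ?_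
  by_cases hP : IsProbabilityMeasure (siteMeasure V τ T)
  · have h := covariance_fun_sum_fun_sum' (μ := gibbs V τ T) (s := Finset.range n)
      (t := Finset.range n) (X := fun (a : ℕ) ω => f (shift a ω))
      (Y := fun (a : ℕ) ω => f (shift a ω)) (fun a _ => memLp_shift f a)
      (fun a _ => memLp_shift f a)
    simp only [cov_shift_shift] at h
    rw [← h]
    exact integral_nonneg fun ω => mul_self_nonneg _
  · simp [corr_eq_zero_of_not hP]

end Aux

instance instCore (V : ℝ → ℝ) (τ T : ℝ) : PreInnerProductSpace.Core ℝ (LocalFun V τ T) where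
  inner f g := semiInner V τ T f g
  conj_inner_symm f g := semiInner_comm g f
  re_inner_nonneg f := semiInner_self_nonneg f
  add_left f g h := semiInner_add_left f g h
  smul_left f g c := semiInner_smul_left c f g

instance (V : ℝ → ℝ) (τ T : ℝ) : SeminormedAddCommGroup (LocalFun V τ T) :=
  InnerProductSpace.Core.toSeminormedAddCommGroup (𝕜 := ℝ)

instance (V : ℝ → ℝ) (τ T : ℝ) : InnerProductSpace ℝ (LocalFun V τ T) :=
  InnerProductSpace.ofCore (instCore V τ T)

/-- The Hilbert space `𝓗 = 𝓗_{τ,T}`: the completion of the space of local functions with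
respect to the semi-inner product `≪·,·≫`. -/
abbrev Hilb (V : ℝ → ℝ) (τ T : ℝ) : Type := UniformSpace.Completion (LocalFun V τ T)

/-- The class in `𝓗` of a local function. -/
def cls {V : ℝ → ℝ} {τ T : ℝ} (f : LocalFun V τ T) : Hilb V τ T :=
  UniformSpace.Completion.coe' f

lemma inner_cls {V : ℝ → ℝ} {τ T : ℝ} (f g : LocalFun V τ T) :
    inner ℝ (cls f) (cls g) = semiInner V τ T f g :=
  UniformSpace.Completion.inner_coe f g

/-- The space `𝓗^a`: the (closed) subspace of `𝓗` of functions antisymmetric in the momenta,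
i.e. the closure of the classes of the local `f` with `f(r,-p) = -f(r,p)`. -/
def antisymmSpace (V : ℝ → ℝ) (τ T : ℝ) : Set (Hilb V τ T) :=
  closure (cls '' {f : LocalFun V τ T | ∀ ω, f (reverseMomenta ω) = -f ω})

/-! ### The generator -/

/-- `C_0^1(Ω)`: continuously differentiable, compactly supported functions of finitely many
coordinates. -/
def IsC01 (f : Config → ℝ) : Prop :=
  ∃ (Λ : Finset ℤ) (F : (Λ → ℝ × ℝ) → ℝ), ContDiff ℝ 1 F ∧ HasCompactSupport F ∧
    ∀ ω, f ω = F fun x => ω x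

/-- `∂_{r_x} f`. -/
def partialR (x : ℤ) (f : Config → ℝ) (ω : Config) : ℝ :=
  deriv (fun s => f (Function.update ω x (s, (ω x).2))) (ω x).1

/-- `∂_{p_x} f`. -/
def partialP (x : ℤ) (f : Config → ℝ) (ω : Config) : ℝ :=
  deriv (fun s => f (Function.update ω x ((ω x).1, s))) (ω x).2

/-- The Liouville operator `𝔄`; for local `f` the sum has finitely many nonzero terms. -/
def liouville (V : ℝ → ℝ) (f : Config → ℝ) (ω : Config) : ℝ :=
  ∑ᶠ x : ℤ, (((ω x).2 - (ω (x - 1)).2) * partialR x f ω +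
    (deriv V (ω (x + 1)).1 - deriv V (ω x).1) * partialP x f ω)

/-- The noise operator `𝔖`; for local `f` the sum has finitely many nonzero terms. -/
def noise (f : Config → ℝ) (ω : Config) : ℝ := ∑ᶠ x : ℤ, (f (flipAt x ω) - f ω)

/-- The graph in `𝓗 × 𝓗` of `𝔄 + γ 𝔖` on `C_0^1(Ω)`. -/
def preGraph (V : ℝ → ℝ) (τ T γ : ℝ) : Set (Hilb V τ T × Hilb V τ T) :=
  {z | ∃ f g : LocalFun V τ T, IsC01 f ∧ (∀ ω, g ω = liouville V f ω + γ * noise f ω) ∧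
    z = (cls f, cls g)}

/-- The (possibly unbounded) operator `L` is the generator of a strongly continuous semigroup
`(P_t)_{t ≥ 0}` of bounded operators: `u ∈ D(L)` and `L u = v` iff `(P_t u - u) / t → v` as
`t ↓ 0`. -/
def IsC0Generator {E : Type*} [NormedAddCommGroup E] [NormedSpace ℝ E] (L : E →ₗ.[ℝ] E) : Prop :=
  ∃ P : ℝ≥0 → E →L[ℝ] E, P 0 = ContinuousLinearMap.id ℝ E ∧
    (∀ s t, P (s + t) = (P s).comp (P t)) ∧
    (∀ u, Continuous fun t => P t u) ∧
    ∀ u v, (u, v) ∈ L.graph ↔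
      Tendsto (fun t : ℝ≥0 => (t : ℝ)⁻¹ • (P t u - u)) (𝓝[>] 0) (𝓝 v)

/-- `L` is the infinite volume generator `𝔏 = 𝔄 + γ 𝔖` in `𝓗`: it generates a strongly
continuous semigroup, it is given by `𝔄 + γ 𝔖` on `C_0^1(Ω) ⊆ D(L)`, and `C_0^1(Ω)` is dense
in `D(L)` for the graph norm. -/
structure IsChainGenerator (V : ℝ → ℝ) (τ T γ : ℝ) (L : Hilb V τ T →ₗ.[ℝ] Hilb V τ T) :
    Prop where
  generates : IsC0Generator L
  extend : preGraph V τ T γ ⊆ L.graph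
  core : (L.graph : Set (Hilb V τ T × Hilb V τ T)) ⊆ closure (preGraph V τ T γ)

/-- `(s - L)⁻¹ g`: the `u ∈ D(L)` with `s u - L u = g`, meaningful when `s - L` is a bijection
from `D(L)` onto the whole space. -/
def resolventApply {E : Type*} [NormedAddCommGroup E] [NormedSpace ℝ E] (L : E →ₗ.[ℝ] E)
    (s : ℝ) (g : E) : E :=
  (Function.invFun (fun u : L.domain => s • (u : E) - L u) g : L.domain)

end FlipChain

end

open FlipChain

/-! Let `J` be momentum reversal on `𝓗`, an orthogonal involution equal to `-1` on `𝓗^a`. All that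
the argument needs from the chain is collected in `IsReversible`. First, `J L` is symmetric: the
Hamiltonian part is antisymmetric and anticommutes with `J`, while the noise is symmetric and
commutes with `J`. Second, `≪u, L u≫ ≤ -γ (‖u‖² - ≪u, J u≫) = -(γ/2) ‖u - J u‖²`: the Hamiltonian
part drops out, and the flips have a spectral gap on functions odd in the momenta. Both facts are
closed conditions on the graph, so it suffices to check them on the core `C_0^1`
(`semiInner_generator_reverse`, `semiInner_generator_le`).

Dissipativity makes the semigroup contractive, and its Laplace transform then inverts `s - L` for
every `s > 0` (`IsC0Generator.bijective`).

For the limit, let `u_s = (s - L)⁻¹ f` with `f ∈ 𝓗^a`. Reversibility gives `d/ds ≪f, u_s≫ = ≪u_s, J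
u_s≫ = ‖u_s‖² - ½ ‖u_s - J u_s‖²` (`IsReversible.resolvent_identity`). No bound on `u_s` uniform in
`s` is available, but coercivity controls its antisymmetric part: `γ ‖u_s - J u_s‖ ≤ ‖f‖`. The
derivative is therefore bounded below, and `≪f, u_s≫`, which is nonnegative, becomes monotone after
a linear function of `s` is added; hence it converges as `s ↓ 0`
(`IsReversible.exists_tendsto_form`). Polarization handles pairs `f, g`, and symmetry already holds
for each `s > 0`.

The gap is proved first in `L²(μ)`, from `1 - φψ ≤ (1 - φ) + (1 - ψ)` for commuting measure
preserving involutions (`integral_mul_noise_le`). It is carried to `≪·,·≫` by applying it to the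
block sums `∑_{a<n} θ_a f`: boundary effects stay bounded in `n` while the bulk grows linearly
(`tsum_nonneg_of_forms`). -/

namespace FlipChain

/-! ### Strongly continuous semigroups and their generators -/

section Semigroup

variable {E : Type*} [NormedAddCommGroup E]

/-- Right difference quotients along `ℝ≥0` are those along `ℝ`. -/
lemma tendsto_nnreal_right_iff (φ : ℝ → E) (v : E) :
    Tendsto (fun t : ℝ≥0 => φ t) (𝓝[>] 0) (𝓝 v) ↔ Tendsto φ (𝓝[>] 0) (𝓝 v) := by
  have h : map ((↑) : ℝ≥0 → ℝ) (𝓝[>] 0) = 𝓝[>] (0 : ℝ) := by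
    have := NNReal.isEmbedding_coe.map_nhdsWithin_eq (Set.Ioi (0 : ℝ≥0)) 0
    rw [this]
    congr 1
    ext x
    constructor
    · rintro ⟨y, hy, rfl⟩
      exact_mod_cast hy
    · intro hx
      exact ⟨⟨x, le_of_lt hx⟩, by exact_mod_cast hx, rfl⟩
  rw [← h, tendsto_map'_iff]
  rfl

variable [NormedSpace ℝ E]

/-- A strongly continuous one-parameter semigroup of bounded operators. -/
structure IsC0Semigroup (P : ℝ≥0 → E →L[ℝ] E) : Prop where
  zero : P 0 = ContinuousLinearMap.id ℝ E
  add : ∀ s t, P (s + t) = (P s).comp (P t)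
  cont : ∀ u, Continuous fun t => P t u

/-- The orbit of `u`, as a function on the real line (constant on the negative half-line). -/
def orbit (P : ℝ≥0 → E →L[ℝ] E) (u : E) (t : ℝ) : E := P t.toNNReal u

/-- `v` is the value at `u` of the generator of `P`. -/
def GeneratorAt (P : ℝ≥0 → E →L[ℝ] E) (u v : E) : Prop :=
  HasDerivWithinAt (orbit P u) v (Set.Ici 0) 0

variable {P : ℝ≥0 → E →L[ℝ] E}

lemma IsC0Semigroup.continuous_orbit (hP : IsC0Semigroup P) (u : E) : Continuous (orbit P u) :=
  (hP.cont u).comp continuous_real_toNNReal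

lemma IsC0Semigroup.orbit_zero (hP : IsC0Semigroup P) (u : E) : orbit P u 0 = u := by
  simp [orbit, hP.zero]

lemma IsC0Semigroup.orbit_add (hP : IsC0Semigroup P) (u : E) {s t : ℝ} (hs : 0 ≤ s)
    (ht : 0 ≤ t) : P s.toNNReal (orbit P u t) = orbit P u (s + t) := by
  simp [orbit, Real.toNNReal_add hs ht, hP.add]

lemma IsC0Semigroup.generatorAt_iff (hP : IsC0Semigroup P) (u v : E) :
    GeneratorAt P u v ↔ Tendsto (fun t : ℝ≥0 => (t : ℝ)⁻¹ • (P t u - u)) (𝓝[>] 0) (𝓝 v) := by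
  rw [GeneratorAt, ← hasDerivWithinAt_Ioi_iff_Ici, hasDerivWithinAt_iff_tendsto_slope' (by simp),
    ← tendsto_nnreal_right_iff]
  refine tendsto_congr fun t => ?_
  simp [slope, orbit, hP.zero]

/-- The domain of the generator is invariant and the generator commutes with the semigroup. -/
lemma GeneratorAt.apply {u v : E} (hP : IsC0Semigroup P) (h : GeneratorAt P u v) {t : ℝ}
    (ht : 0 ≤ t) : GeneratorAt P (orbit P u t) (orbit P v t) := by
  have h1 := (P t.toNNReal).hasFDerivAt.comp_hasDerivWithinAt (0 : ℝ) h
  refine h1.congr (fun s hs => ?_) ?_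
  · simp only [Function.comp]
    rw [hP.orbit_add u ht hs, add_comm, ← hP.orbit_add u hs ht, orbit]
  · simp only [Function.comp]
    rw [hP.orbit_zero, hP.orbit_zero, orbit]

/-- The semigroup law transports the derivative at `0` to time `t`. Only right derivatives come out
this way, which is enough for the one-sided comparison theorem used for contractivity. -/
lemma GeneratorAt.hasDerivWithinAt {u v : E} (hP : IsC0Semigroup P) (h : GeneratorAt P u v)
    {t : ℝ} (ht : 0 ≤ t) : HasDerivWithinAt (orbit P u) (orbit P v t) (Set.Ici t) t := by
  have h1 := h.apply hP ht
  have h2 : HasDerivWithinAt (fun s : ℝ => s - t) 1 (Set.Ici t) t :=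
    ((hasDerivAt_id t).sub_const t).hasDerivWithinAt
  have h1' : HasDerivWithinAt (orbit P (orbit P u t)) (orbit P v t) (Set.Ici 0) (t - t) := by
    simpa [GeneratorAt] using h1
  have h3 := HasDerivWithinAt.scomp (h := fun s : ℝ => s - t) t h1' h2
    (fun s hs => by simpa using hs)
  rw [one_smul] at h3
  refine h3.congr (fun s hs => ?_) ?_
  · have hs' : 0 ≤ s - t := sub_nonneg.2 hs
    simp only [Function.comp]
    rw [orbit.eq_def P (orbit P u t), hP.orbit_add u hs' ht, sub_add_cancel]
  · simp [hP.orbit_zero]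

/-- The domain of the generator is dense. -/
lemma IsC0Semigroup.exists_generatorAt_mem [CompleteSpace E] (hP : IsC0Semigroup P) :
    Dense {u : E | ∃ v, GeneratorAt P u v} := by
  intro u
  -- The averages `t⁻¹ ∫₀ᵗ P_s u ds` lie in the domain and tend to `u` as `t ↓ 0`.
  set F : ℝ → E := fun t => ∫ s in (0 : ℝ)..t, orbit P u s with hF
  have hc := hP.continuous_orbit u
  have hF' : ∀ t, HasDerivAt F (orbit P u t) t := fun t => hc.integral_hasStrictDerivAt 0 t
    |>.hasDerivAt
  have hmem : ∀ t : ℝ, 0 ≤ t → GeneratorAt P (F t) (orbit P u t - u) := by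
    intro t ht
    have h1 : HasDerivAt (fun h => F (t + h) - F h) (orbit P u t - orbit P u 0) 0 := by
      refine HasDerivAt.sub ?_ (hF' 0)
      have h0 : HasDerivAt F (orbit P u t) (t + 0) := by simpa using hF' t
      simpa using h0.comp_const_add t 0
    rw [hP.orbit_zero] at h1
    -- Applying `P_h` under the integral shifts the window to `[h, t + h]`, so differentiability in
    -- `h` reduces to the fundamental theorem of calculus.
    have h2 : ∀ h : ℝ, 0 ≤ h → orbit P (F t) h = F (t + h) - F h := by
      intro h hh
      rw [orbit]
      simp only [hF]
      rw [← ContinuousLinearMap.intervalIntegral_comp_comm _ (hc.intervalIntegrable _ _)]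
      rw [intervalIntegral.integral_interval_sub_left (hc.intervalIntegrable _ _)
        (hc.intervalIntegrable _ _)]
      have h3 : ∫ s in (0 : ℝ)..t, P h.toNNReal (orbit P u s) =
          ∫ s in (0 : ℝ)..t, orbit P u (s + h) := by
        refine intervalIntegral.integral_congr fun s hs => ?_
        rw [Set.uIcc_of_le ht] at hs
        rw [hP.orbit_add u hh hs.1, add_comm]
      rw [h3, intervalIntegral.integral_comp_add_right (fun s => orbit P u s)]
      simp
    exact h1.hasDerivWithinAt.congr (fun h hh => h2 h hh) (h2 0 le_rfl)
  have h0 : Tendsto (fun t : ℝ => t⁻¹ • F t) (𝓝[>] 0) (𝓝 u) := by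
    have := (hF' 0).hasDerivWithinAt (s := Set.Ioi 0)
    rw [hasDerivWithinAt_iff_tendsto_slope' (by simp), hP.orbit_zero] at this
    refine this.congr fun t => ?_
    simp [slope, hF]
  refine mem_closure_of_tendsto h0 ?_
  filter_upwards [self_mem_nhdsWithin] with t ht
  refine ⟨t⁻¹ • (orbit P u t - u), ?_⟩
  have := (hmem t (le_of_lt ht)).const_smul t⁻¹
  refine this.congr (fun s _ => ?_) ?_ <;> simp [orbit]

end Semigroup

/-! ### Contractivity and the Laplace transform -/

section Dissipative

variable {E : Type*} [NormedAddCommGroup E] [InnerProductSpace ℝ E] [CompleteSpace E]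
  {P : ℝ≥0 → E →L[ℝ] E}

/-- A strongly continuous semigroup with dissipative generator is contractive. -/
lemma IsC0Semigroup.norm_orbit_le (hP : IsC0Semigroup P)
    (hdiss : ∀ u v, GeneratorAt P u v → inner ℝ u v ≤ 0) (u : E) {t : ℝ} (ht : 0 ≤ t) :
    ‖orbit P u t‖ ≤ ‖u‖ := by
  have hclosed : IsClosed {u : E | ‖orbit P u t‖ ≤ ‖u‖} := by
    unfold orbit
    exact isClosed_le (by fun_prop) (by fun_prop)
  refine closure_minimal ?_ hclosed (hP.exists_generatorAt_mem u)
  rintro u ⟨v, huv⟩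
  have hsq : ‖orbit P u t‖ ^ 2 ≤ ‖u‖ ^ 2 := by
    -- On the domain `‖P_s u‖²` has right derivative `2 ⟨P_s u, L P_s u⟩ ≤ 0`; density of the domain
    -- then gives the bound for every `u`.
    have hder : ∀ s ∈ Set.Ico 0 t, HasDerivWithinAt (fun s => ‖orbit P u s‖ ^ 2)
        (2 * inner ℝ (orbit P u s) (orbit P v s)) (Set.Ici s) s := fun s hs =>
      (huv.hasDerivWithinAt hP hs.1).norm_sq
    have := image_le_of_deriv_right_le_deriv_boundary
      (f := fun s => ‖orbit P u s‖ ^ 2) (a := 0) (b := t) (B := fun _ => ‖u‖ ^ 2)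
      (B' := fun _ => 0) ((hP.continuous_orbit u).norm.pow 2).continuousOn hder
      (by simp [hP.orbit_zero]) continuousOn_const
      (fun s _ => (hasDerivAt_const _ _).hasDerivWithinAt)
      (fun s hs => by have := hdiss _ _ (huv.apply hP hs.1); linarith)
    exact this ⟨ht, le_rfl⟩
  exact (sq_le_sq₀ (norm_nonneg _) (norm_nonneg _)).1 hsq

/-- The Laplace transform of a contractive semigroup inverts `s - L`. -/
lemma IsC0Semigroup.exists_resolvent (hP : IsC0Semigroup P)
    (hcontr : ∀ (u : E) (t : ℝ), 0 ≤ t → ‖orbit P u t‖ ≤ ‖u‖) {s : ℝ} (hs : 0 < s) (y : E) :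
    ∃ u, GeneratorAt P u (s • u - y) := by
  set q : ℝ → E := fun t => Real.exp (-s * t) • orbit P y t with hq
  have hqc : Continuous q := by
    have := hP.continuous_orbit y
    fun_prop
  have hint : IntegrableOn q (Set.Ioi 0) := by
    refine Integrable.mono' ((integrableOn_exp_mul_Ioi (a := -s) (by linarith) 0).mul_const ‖y‖)
      hqc.aestronglyMeasurable ?_
    filter_upwards [ae_restrict_mem measurableSet_Ioi] with t ht
    rw [hq]
    simp only [norm_smul, Real.norm_eq_abs, Real.abs_exp]
    exact mul_le_mul_of_nonneg_left (hcontr y t (le_of_lt ht)) (Real.exp_pos _).le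
  set u : E := ∫ t in Set.Ioi (0 : ℝ), q t with hu
  refine ⟨u, ?_⟩
  -- For `u = ∫₀^∞ e^{-st} P_t y dt`, a change of variables expresses `P_h u` through the tail of
  -- the same integral. The right side is differentiable at `h = 0` with derivative `s u - y`.
  have h2 : ∀ h : ℝ, 0 ≤ h → orbit P u h = Real.exp (s * h) • (u - ∫ t in (0 : ℝ)..h, q t) := by
    intro h hh
    have e1 : u - ∫ t in (0 : ℝ)..h, q t = ∫ t in Set.Ioi h, q t := by
      rw [sub_eq_iff_eq_add, add_comm, hu]
      exact (intervalIntegral.integral_interval_add_Ioi hint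
        (hint.mono_set (Set.Ioi_subset_Ioi hh))).symm
    have e2 : ∫ t in Set.Ioi h, q t = ∫ t in Set.Ioi (0 : ℝ), q (t + h) := by
      have := (measurePreserving_add_right volume h).setIntegral_preimage_emb
        (measurableEmbedding_addRight h) q (Set.Ioi h)
      rw [← this]
      simp
    rw [e1, e2, ← integral_smul, hu, orbit, ← ContinuousLinearMap.integral_comp_comm _ hint]
    refine setIntegral_congr_fun measurableSet_Ioi fun t ht => ?_
    simp only [hq, map_smul, smul_smul]
    rw [hP.orbit_add y hh (le_of_lt ht), ← Real.exp_add, add_comm h t]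
    congr 2
    ring
  have hd : HasDerivAt (fun h : ℝ => Real.exp (s * h) • (u - ∫ t in (0 : ℝ)..h, q t))
      (Real.exp (s * 0) • (-(q 0)) + (Real.exp (s * 0) * (s * 1)) • (u - ∫ t in (0 : ℝ)..0, q t))
      0 := by
    refine HasDerivAt.smul ((hasDerivAt_id (0 : ℝ)).const_mul s).exp ?_
    exact (hqc.integral_hasStrictDerivAt 0 0).hasDerivAt.const_sub u
  have hd' : HasDerivAt (fun h : ℝ => Real.exp (s * h) • (u - ∫ t in (0 : ℝ)..h, q t))
      (s • u - y) 0 := by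
    convert hd using 1
    simp [hq, hP.orbit_zero]
    abel
  exact hd'.hasDerivWithinAt.congr (fun h hh => h2 h hh) (h2 0 le_rfl)

end Dissipative

/-! ### Resolvents of reversible, partially coercive generators -/

section Abstract

variable {E : Type*} [NormedAddCommGroup E] [InnerProductSpace ℝ E]

/-- If `L` generates a strongly continuous semigroup and is dissipative, then `s - L` is a bijection
from the domain of `L` onto the whole space for all `s > 0`. -/
lemma IsC0Generator.bijective [CompleteSpace E] {L : E →ₗ.[ℝ] E} (hL : IsC0Generator L)
    (hdiss : ∀ u v, (u, v) ∈ L.graph → inner ℝ u v ≤ 0) {s : ℝ} (hs : 0 < s) :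
    Function.Bijective fun u : L.domain => s • (u : E) - L u := by
  obtain ⟨P, h0, hadd, hcont, hgraph⟩ := hL
  have hP : IsC0Semigroup P := ⟨h0, hadd, hcont⟩
  have hgr : ∀ u v, (u, v) ∈ L.graph ↔ GeneratorAt P u v := fun u v =>
    (hgraph u v).trans (hP.generatorAt_iff u v).symm
  constructor
  · intro u v huv
    -- An element `w` of the kernel satisfies `L w = s w`, and dissipativity then forces `s ‖w‖² ≤
    -- 0`.
    have h1 := hdiss _ _ (L.mem_graph (u - v))
    have h2 : L (u - v) = s • ((u - v : L.domain) : E) := by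
      rw [L.map_sub, Submodule.coe_sub, smul_sub]
      simp only at huv
      rw [sub_eq_sub_iff_add_eq_add] at huv ⊢
      rw [add_comm (L u), huv, add_comm]
    rw [h2, inner_smul_right, real_inner_self_eq_norm_sq] at h1
    have h3 : ‖((u - v : L.domain) : E)‖ ^ 2 ≤ 0 := by
      by_contra h
      push Not at h
      nlinarith [mul_pos hs h]
    have h4 : ((u - v : L.domain) : E) = 0 := by
      rw [← norm_eq_zero]
      exact pow_eq_zero_iff (two_ne_zero) |>.1 (le_antisymm h3 (sq_nonneg _))
    rw [Submodule.coe_sub, sub_eq_zero] at h4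
    exact Subtype.ext h4
  · intro y
    obtain ⟨u, hu⟩ := hP.exists_resolvent (fun u t ht => hP.norm_orbit_le
      (fun u v h => hdiss u v ((hgr u v).2 h)) u ht) hs y
    have := (hgr _ _).2 hu
    rw [LinearPMap.mem_graph_iff] at this
    obtain ⟨w, hw, hw'⟩ := this
    refine ⟨w, ?_⟩
    simp only at hw hw' ⊢
    rw [hw', hw, sub_sub_cancel]

/-- Puts the resolvent equation `L u = s u - g` in graph form, the only form in which the resolvent
is used below. -/
lemma resolventApply_mem_graph {L : E →ₗ.[ℝ] E} {s : ℝ}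
    (hbij : Function.Bijective fun u : L.domain => s • (u : E) - L u) (g : E) :
    (resolventApply L s g, s • resolventApply L s g - g) ∈ L.graph := by
  have h := Function.rightInverse_invFun hbij.2 g
  rw [LinearPMap.mem_graph_iff]
  refine ⟨Function.invFun (fun u : L.domain => s • (u : E) - L u) g, rfl, ?_⟩
  rw [eq_sub_iff_add_eq, ← eq_sub_iff_add_eq']
  exact h.symm

lemma resolventApply_unique {L : E →ₗ.[ℝ] E} {s : ℝ}
    (hbij : Function.Bijective fun u : L.domain => s • (u : E) - L u) {g u : E}
    (h : (u, s • u - g) ∈ L.graph) : resolventApply L s g = u := by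
  rw [LinearPMap.mem_graph_iff] at h
  obtain ⟨w, hw, hw'⟩ := h
  simp only at hw hw'
  have : (fun u : L.domain => s • (u : E) - L u) w = g := by
    simp only
    rw [hw', hw, sub_sub_cancel]
  rw [resolventApply, ← this, Function.leftInverse_invFun hbij.1, hw]

lemma resolventApply_add {L : E →ₗ.[ℝ] E} {s : ℝ}
    (hbij : Function.Bijective fun u : L.domain => s • (u : E) - L u) (f g : E) :
    resolventApply L s (f + g) = resolventApply L s f + resolventApply L s g := by
  refine resolventApply_unique hbij ?_
  convert L.graph.add_mem (resolventApply_mem_graph hbij f) (resolventApply_mem_graph hbij g)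
    using 1
  rw [Prod.mk_add_mk, smul_add]
  congr 1
  abel

/-- A generator `L` with `J L` symmetric for an orthogonal involution `J`, whose symmetric part is
coercive on the space `J = -1`. -/
structure IsReversible (L : E →ₗ.[ℝ] E) (J : E →L[ℝ] E) (c : ℝ) : Prop where
  pos : 0 < c
  invol : ∀ u, J (J u) = u
  symm : ∀ u v, inner ℝ (J u) v = inner ℝ u (J v)
  coercive : ∀ u v, (u, v) ∈ L.graph → inner ℝ u v ≤ -(c * (‖u‖ ^ 2 - inner ℝ u (J u)))
  reversal : ∀ u v u' v', (u, v) ∈ L.graph → (u', v') ∈ L.graph →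
    inner ℝ v (J u') = inner ℝ (J u) v'

variable {L : E →ₗ.[ℝ] E} {J : E →L[ℝ] E} {c : ℝ}

/-- `J` is an isometry, so the quantity in the coercivity bound is half the squared norm of `u - J
u`. This turns coercivity into control of the antisymmetric part. -/
lemma IsReversible.sq_norm_sub (h : IsReversible L J c) (u : E) :
    ‖u - J u‖ ^ 2 = 2 * (‖u‖ ^ 2 - inner ℝ u (J u)) := by
  rw [norm_sub_sq_real, ← real_inner_self_eq_norm_sq (J u), h.symm, h.invol,
    real_inner_self_eq_norm_sq]
  ring

lemma IsReversible.dissipative (h : IsReversible L J c) {u v : E} (huv : (u, v) ∈ L.graph) :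
    inner ℝ u v ≤ 0 := by
  have h1 := h.coercive u v huv
  have h2 := h.sq_norm_sub u
  have h3 : 0 ≤ c * (‖u‖ ^ 2 - inner ℝ u (J u)) :=
    mul_nonneg h.pos.le (by nlinarith [sq_nonneg ‖u - J u‖])
  linarith

/-- Symmetry of `J L` tested on the two resolvent equations; the signs from `J f = -f` and `J g =
-g` make the right sides of these equations contribute a difference. Taking `s = t` gives symmetry
of the resolvent form, and `f = g` gives its derivative in the spectral parameter. -/
lemma IsReversible.resolvent_identity (h : IsReversible L J c)
    (hbij : ∀ s : ℝ, 0 < s → Function.Bijective fun u : L.domain => s • (u : E) - L u)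
    {f g : E} (hf : J f = -f) (hg : J g = -g) {s t : ℝ} (hs : 0 < s) (ht : 0 < t) :
    inner ℝ g (resolventApply L s f) - inner ℝ f (resolventApply L t g) =
      (s - t) * inner ℝ (resolventApply L s f) (J (resolventApply L t g)) := by
  have h1 := h.reversal _ _ _ _ (resolventApply_mem_graph (hbij s hs) f)
    (resolventApply_mem_graph (hbij t ht) g)
  rw [inner_sub_left, inner_sub_right, inner_smul_left, inner_smul_right, ← h.symm f, hf,
    h.symm _ g, hg, inner_neg_left, inner_neg_right, h.symm, real_inner_comm g] at h1
  simp only [RCLike.conj_to_real] at h1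
  linarith

lemma IsReversible.norm_resolvent_le (h : IsReversible L J c)
    (hbij : ∀ s : ℝ, 0 < s → Function.Bijective fun u : L.domain => s • (u : E) - L u)
    (f : E) {s : ℝ} (hs : 0 < s) : s * ‖resolventApply L s f‖ ≤ ‖f‖ := by
  set u := resolventApply L s f
  have h1 := h.dissipative (resolventApply_mem_graph (hbij s hs) f)
  rw [inner_sub_right, inner_smul_right, real_inner_self_eq_norm_sq] at h1
  have h2 := real_inner_le_norm u f
  by_cases h0 : ‖u‖ = 0
  · change s * ‖u‖ ≤ ‖f‖
    rw [h0]
    simp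
  have h3 : 0 < ‖u‖ := lt_of_le_of_ne (norm_nonneg _) (Ne.symm h0)
  refine le_of_mul_le_mul_left ?_ h3
  change ‖u‖ * (s * ‖u‖) ≤ _
  linarith

/-- Pairing `s u - L u = f` with `u` gives `⟨f, u⟩ = s ‖u‖² - ⟨u, L u⟩`, and both terms are
nonnegative. -/
lemma IsReversible.form_nonneg (h : IsReversible L J c)
    (hbij : ∀ s : ℝ, 0 < s → Function.Bijective fun u : L.domain => s • (u : E) - L u)
    (f : E) {s : ℝ} (hs : 0 < s) : 0 ≤ inner ℝ f (resolventApply L s f) := by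
  have h1 := h.dissipative (resolventApply_mem_graph (hbij s hs) f)
  rw [inner_sub_right, inner_smul_right, real_inner_self_eq_norm_sq, real_inner_comm] at h1
  have : 0 ≤ s * ‖resolventApply L s f‖ ^ 2 := by positivity
  linarith

/-- The `J = -1` component of the resolvent is bounded uniformly in the spectral parameter. -/
lemma IsReversible.norm_antisymm_le (h : IsReversible L J c)
    (hbij : ∀ s : ℝ, 0 < s → Function.Bijective fun u : L.domain => s • (u : E) - L u)
    {f : E} (hf : J f = -f) {s : ℝ} (hs : 0 < s) :
    c * ‖resolventApply L s f - J (resolventApply L s f)‖ ≤ ‖f‖ := by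
  set u := resolventApply L s f
  have h1 := h.coercive _ _ (resolventApply_mem_graph (hbij s hs) f)
  change inner ℝ u (s • u - f) ≤ -(c * (‖u‖ ^ 2 - inner ℝ u (J u))) at h1
  have h2 := h.sq_norm_sub u
  -- Since `f` is antisymmetric it sees only the antisymmetric part of `u`. Hence `⟨f, u⟩`, which
  -- bounds the coercive term, is at most `½ ‖f‖ ‖u - J u‖`, and one factor `‖u - J u‖` cancels.
  have h3 : inner ℝ f (u - J u) = 2 * inner ℝ f u := by
    rw [inner_sub_right, ← h.symm, hf, inner_neg_left]
    ring
  have h4 := real_inner_le_norm f (u - J u)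
  rw [inner_sub_right, inner_smul_right, real_inner_self_eq_norm_sq, real_inner_comm] at h1
  have h5 : 0 ≤ s * ‖u‖ ^ 2 := by positivity
  by_cases h0 : ‖u - J u‖ = 0
  · rw [h0]
    simp
  have h6 : 0 < ‖u - J u‖ := lt_of_le_of_ne (norm_nonneg _) (Ne.symm h0)
  refine le_of_mul_le_mul_left ?_ h6
  have h7 : ‖u - J u‖ * (c * ‖u - J u‖) = 2 * (c * (‖u‖ ^ 2 - inner ℝ u (J u))) := by
    linear_combination c * h2
  linarith

/-- The first resolvent identity `R_t f - R_s f = (s - t) R_s R_t f` together with `‖R_s‖ ≤ 1/s`. -/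
lemma IsReversible.norm_resolvent_sub_le (h : IsReversible L J c)
    (hbij : ∀ s : ℝ, 0 < s → Function.Bijective fun u : L.domain => s • (u : E) - L u)
    (f : E) {s t : ℝ} (hs : 0 < s) (ht : 0 < t) :
    s * ‖resolventApply L t f - resolventApply L s f‖ ≤ |s - t| * ‖resolventApply L t f‖ := by
  have h1 := L.graph.sub_mem (resolventApply_mem_graph (hbij t ht) f)
    (resolventApply_mem_graph (hbij s hs) f)
  set u := resolventApply L s f
  set v := resolventApply L t f
  have h2 : resolventApply L s ((s - t) • v) = v - u := by
    refine resolventApply_unique (hbij s hs) ?_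
    convert h1 using 1
    rw [Prod.mk_sub_mk]
    congr 1
    module
  have h3 := h.norm_resolvent_le hbij ((s - t) • v) hs
  rwa [h2, norm_smul, Real.norm_eq_abs] at h3

lemma IsReversible.tendsto_resolvent (h : IsReversible L J c)
    (hbij : ∀ s : ℝ, 0 < s → Function.Bijective fun u : L.domain => s • (u : E) - L u)
    (f : E) {s : ℝ} (hs : 0 < s) :
    Tendsto (fun t => resolventApply L t f) (𝓝 s) (𝓝 (resolventApply L s f)) := by
  rw [tendsto_iff_norm_sub_tendsto_zero]
  have hlim : Tendsto (fun t : ℝ => s⁻¹ * (|s - t| * (t⁻¹ * ‖f‖))) (𝓝 s) (𝓝 0) := by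
    have : ContinuousAt (fun t : ℝ => s⁻¹ * (|s - t| * (t⁻¹ * ‖f‖))) s := by
      have := hs.ne'
      fun_prop (disch := assumption)
    simpa [ContinuousAt] using this
  refine squeeze_zero' (Eventually.of_forall fun _ => norm_nonneg _) ?_ hlim
  filter_upwards [lt_mem_nhds hs] with t ht
  rw [← div_eq_inv_mul, le_div_iff₀ hs, mul_comm]
  refine (h.norm_resolvent_sub_le hbij f hs ht).trans ?_
  refine mul_le_mul_of_nonneg_left ?_ (abs_nonneg _)
  rw [← div_eq_inv_mul, le_div_iff₀ ht, mul_comm]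
  exact h.norm_resolvent_le hbij f ht

/-- By `resolvent_identity` the difference quotient between `t` and `s` equals `⟨R_t f, J R_s f⟩`
exactly, so continuity of `t ↦ R_t f` suffices. -/
lemma IsReversible.hasDerivAt_form (h : IsReversible L J c)
    (hbij : ∀ s : ℝ, 0 < s → Function.Bijective fun u : L.domain => s • (u : E) - L u)
    {f : E} (hf : J f = -f) {s : ℝ} (hs : 0 < s) :
    HasDerivAt (fun t => inner ℝ f (resolventApply L t f))
      (inner ℝ (resolventApply L s f) (J (resolventApply L s f))) s := by
  rw [hasDerivAt_iff_tendsto_slope]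
  have h1 : Tendsto (fun t => inner ℝ (resolventApply L t f) (J (resolventApply L s f))) (𝓝[≠] s)
      (𝓝 (inner ℝ (resolventApply L s f) (J (resolventApply L s f)))) :=
    (Tendsto.inner (h.tendsto_resolvent hbij f hs) tendsto_const_nhds).mono_left nhdsWithin_le_nhds
  refine h1.congr' ?_
  filter_upwards [self_mem_nhdsWithin, nhdsWithin_le_nhds (lt_mem_nhds hs)] with t hts ht
  rw [slope_def_field, h.resolvent_identity hbij hf hf ht hs, mul_div_cancel_left₀]
  exact sub_ne_zero.2 hts

/-- The quadratic form of the resolvent converges on vectors with `J f = -f`. -/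
lemma IsReversible.exists_tendsto_form (h : IsReversible L J c)
    (hbij : ∀ s : ℝ, 0 < s → Function.Bijective fun u : L.domain => s • (u : E) - L u)
    {f : E} (hf : J f = -f) :
    ∃ l, Tendsto (fun s => inner ℝ f (resolventApply L s f)) (𝓝[>] 0) (𝓝 l) := by
  -- `K` bounds `‖u_s - J u_s‖²` uniformly in `s`. The derivative `‖u_s‖² - ½ ‖u_s - J u_s‖²` is
  -- thus at least `-K/2`, and adding `K t` makes the form monotone.
  set K : ℝ := (‖f‖ / c) ^ 2 with hK
  have hder : ∀ s : ℝ, 0 < s → HasDerivAt (fun t => inner ℝ f (resolventApply L t f) + K * t)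
      (inner ℝ (resolventApply L s f) (J (resolventApply L s f)) + K * 1) s := fun s hs =>
    (h.hasDerivAt_form hbij hf hs).add ((hasDerivAt_id s).const_mul K)
  have hmono : MonotoneOn (fun t => inner ℝ f (resolventApply L t f) + K * t) (Set.Ioi 0) := by
    refine monotoneOn_of_deriv_nonneg (convex_Ioi 0)
      (fun s hs => (hder s hs).continuousAt.continuousWithinAt)
      (fun s hs => (hder s (by simpa using hs)).differentiableAt.differentiableWithinAt) ?_
    intro s hs
    have hs' : 0 < s := by simpa using hs
    rw [(hder s hs').deriv]
    have h1 := h.norm_antisymm_le hbij hf hs'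
    set u := resolventApply L s f
    have h2 := h.sq_norm_sub u
    have h3 : ‖u - J u‖ ^ 2 ≤ K := by
      rw [hK]
      refine pow_le_pow_left₀ (norm_nonneg _) ?_ 2
      rwa [le_div_iff₀ h.pos, mul_comm]
    nlinarith [sq_nonneg ‖u‖]
  have hbdd : BddBelow ((fun t => inner ℝ f (resolventApply L t f) + K * t) '' Set.Ioi 0) := by
    refine ⟨0, ?_⟩
    rintro _ ⟨s, hs, rfl⟩
    have h1 := h.form_nonneg hbij f hs
    have h2 : 0 ≤ K * s := mul_nonneg (sq_nonneg _) (le_of_lt hs)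
    simp only
    linarith
  have h1 := hmono.tendsto_nhdsGT hbdd
  have h2 : Tendsto (fun t : ℝ => K * t) (𝓝[>] 0) (𝓝 (K * 0)) :=
    ((continuous_const.mul continuous_id).tendsto 0).mono_left nhdsWithin_le_nhds
  refine ⟨_, (h1.sub h2).congr fun t => ?_⟩
  ring

/-- Polarization, legitimate because the resolvent form is symmetric at each fixed `s` on the space
`J = -1`. -/
lemma IsReversible.exists_tendsto_inner (h : IsReversible L J c)
    (hbij : ∀ s : ℝ, 0 < s → Function.Bijective fun u : L.domain => s • (u : E) - L u)
    {f g : E} (hf : J f = -f) (hg : J g = -g) :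
    ∃ l, Tendsto (fun s => inner ℝ f (resolventApply L s g)) (𝓝[>] 0) (𝓝 l) := by
  obtain ⟨l₁, h₁⟩ := h.exists_tendsto_form hbij hf
  obtain ⟨l₂, h₂⟩ := h.exists_tendsto_form hbij hg
  obtain ⟨l₃, h₃⟩ := h.exists_tendsto_form hbij (f := f + g) (by rw [map_add, hf, hg]; abel)
  refine ⟨(l₃ - l₁ - l₂) / 2, (((h₃.sub h₁).sub h₂).div_const 2).congr' ?_⟩
  filter_upwards [self_mem_nhdsWithin] with s hs
  have hsymm := h.resolvent_identity hbij hf hg hs hs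
  rw [sub_self, zero_mul, sub_eq_zero] at hsymm
  rw [resolventApply_add (hbij s hs), inner_add_left, inner_add_right, inner_add_right, hsymm]
  ring

/-- Existence and symmetry of the limit of the resolvent form on the space `J = -1`. -/
theorem IsReversible.exists_symmetric_limit (h : IsReversible L J c)
    (hbij : ∀ s : ℝ, 0 < s → Function.Bijective fun u : L.domain => s • (u : E) - L u)
    {S : Set E} (hS : ∀ f ∈ S, J f = -f) :
    ∃ σ : E → E → ℝ,
      (∀ f ∈ S, ∀ g ∈ S,
        Tendsto (fun s : ℝ => inner ℝ f (resolventApply L s g)) (𝓝[>] 0) (𝓝 (σ f g))) ∧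
      ∀ f ∈ S, ∀ g ∈ S, σ f g = σ g f := by
  -- Off `S` the limit may fail to exist and `lim` is then an arbitrary value; nothing is claimed
  -- there.
  refine ⟨fun f g => lim (map (fun s : ℝ => inner ℝ f (resolventApply L s g)) (𝓝[>] 0)), ?_, ?_⟩
  · intro f hf g hg
    exact tendsto_nhds_limUnder (h.exists_tendsto_inner hbij (hS f hf) (hS g hg))
  · intro f hf g hg
    have h1 := tendsto_nhds_limUnder (h.exists_tendsto_inner hbij (hS f hf) (hS g hg))
    have h2 := tendsto_nhds_limUnder (h.exists_tendsto_inner hbij (hS g hg) (hS f hf))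
    refine tendsto_nhds_unique h1 (h2.congr' ?_)
    filter_upwards [self_mem_nhdsWithin] with s hs
    have hsymm := h.resolvent_identity hbij (hS f hf) (hS g hg) hs hs
    rwa [sub_self, zero_mul, sub_eq_zero] at hsymm

end Abstract

/-! ### Integration by parts on the line -/

section Tilted

/-- Integration by parts for a measure with smooth density `exp U`. -/
lemma integral_deriv_tilted {U U' : ℝ → ℝ} (hU : ∀ r, HasDerivAt U (U' r) r)
    (hint : Integrable fun r => Real.exp (U r)) (hint' : Integrable U' (volume.tilted U))
    {φ φ' : ℝ → ℝ} (hφ : ∀ r, HasDerivAt φ (φ' r) r) (hmeas : Measurable φ') {C : ℝ}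
    (hC : ∀ r, |φ r| ≤ C) (hC' : ∀ r, |φ' r| ≤ C) :
    ∫ r, φ' r ∂(volume.tilted U) = -∫ r, φ r * U' r ∂(volume.tilted U) := by
  have hφm : Measurable φ := (continuous_iff_continuousAt.2 fun r => (hφ r).continuousAt).measurable
  have hi' : Integrable fun r => Real.exp (U r) * U' r := by
    simpa using (integrable_tilted_iff hint _).1 hint'
  have key := integral_mul_deriv_eq_deriv_mul_of_integrable (u := φ) (v := fun r => Real.exp (U r))
    (u' := φ') (v' := fun r => Real.exp (U r) * U' r) (fun r _ => hφ r) (fun r _ => (hU r).exp)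
    (hi'.bdd_mul (c := C) hφm.aestronglyMeasurable (Eventually.of_forall hC))
    (hint.bdd_mul (c := C) hmeas.aestronglyMeasurable (Eventually.of_forall hC'))
    (hint.bdd_mul (c := C) hφm.aestronglyMeasurable (Eventually.of_forall hC))
  rw [integral_tilted, integral_tilted]
  set Z := ∫ r, Real.exp (U r)
  have e1 : ∫ r, (Real.exp (U r) / Z) • φ' r = Z⁻¹ * ∫ r, φ' r * Real.exp (U r) := by
    rw [← integral_const_mul]
    refine integral_congr_ae (Eventually.of_forall fun r => ?_)
    simp only [smul_eq_mul]
    ring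
  have e2 : ∫ r, (Real.exp (U r) / Z) • (φ r * U' r) =
      Z⁻¹ * ∫ r, φ r * (Real.exp (U r) * U' r) := by
    rw [← integral_const_mul]
    refine integral_congr_ae (Eventually.of_forall fun r => ?_)
    simp only [smul_eq_mul]
    ring
  rw [e1, e2, key]
  ring

/-- Allows a single integration by parts formula to serve both the distances and the momenta. -/
lemma gaussianReal_eq_tilted {v : ℝ≥0} (hv : v ≠ 0) :
    gaussianReal 0 v = volume.tilted fun p => -p ^ 2 / (2 * v) := by
  have hv' : (0 : ℝ) < v := by positivity
  have hI : ∫ p : ℝ, Real.exp (-p ^ 2 / (2 * v)) = √(2 * Real.pi * v) := by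
    have := integral_gaussian (1 / (2 * v : ℝ))
    have e : ∀ p : ℝ, -p ^ 2 / (2 * v) = -(1 / (2 * v : ℝ)) * p ^ 2 := fun p => by ring
    simp_rw [e, this]
    congr 1
    field_simp
  rw [gaussianReal_of_var_ne_zero 0 hv, Measure.tilted, hI]
  congr 1
  ext p
  rw [gaussianPDF, gaussianPDFReal]
  congr 1
  rw [sub_zero, mul_comm, div_eq_mul_inv (Real.exp _)]

lemma integral_deriv_gaussianReal {T : ℝ} (hT : 0 < T)
    {φ φ' : ℝ → ℝ} (hφ : ∀ r, HasDerivAt φ (φ' r) r) (hmeas : Measurable φ') {C : ℝ}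
    (hC : ∀ r, |φ r| ≤ C) (hC' : ∀ r, |φ' r| ≤ C) :
    ∫ p, φ' p ∂(gaussianReal 0 T.toNNReal) = T⁻¹ * ∫ p, φ p * p ∂(gaussianReal 0 T.toNNReal) := by
  have hv : T.toNNReal ≠ 0 := by simpa using hT
  have hcoe : (T.toNNReal : ℝ) = T := Real.coe_toNNReal T hT.le
  have hid : Integrable (fun p : ℝ => p) (gaussianReal 0 T.toNNReal) :=
    (memLp_id_gaussianReal 1).integrable le_rfl
  have hU : ∀ p : ℝ, HasDerivAt (fun p : ℝ => -p ^ 2 / (2 * (T.toNNReal : ℝ))) (-(T⁻¹ * p)) p := by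
    intro p
    rw [hcoe]
    refine (((hasDerivAt_pow 2 p).fun_neg).div_const (2 * T)).congr_deriv ?_
    field_simp
    simp
  have hexp : Integrable fun p : ℝ => Real.exp (-p ^ 2 / (2 * (T.toNNReal : ℝ))) := by
    rw [hcoe]
    refine (integrable_exp_neg_mul_sq (b := 1 / (2 * T)) (by positivity)).congr
      (Eventually.of_forall fun p => ?_)
    simp only
    congr 1
    ring
  have h := integral_deriv_tilted hU hexp
    (by rw [← gaussianReal_eq_tilted hv]; exact (hid.const_mul _).neg) hφ hmeas hC hC'
  rw [← gaussianReal_eq_tilted hv] at h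
  rw [h, ← integral_neg, ← integral_const_mul]
  refine integral_congr_ae (Eventually.of_forall fun p => ?_)
  simp only
  ring

end Tilted

/-! ### Growth of the potential and integrability under the one-site measure -/

section Potential

variable {V : ℝ → ℝ} {τ T : ℝ}

lemma IsPotential.differentiable (hV : IsPotential V) : Differentiable ℝ V :=
  hV.smooth.differentiable (by simp)

lemma IsPotential.continuous_deriv (hV : IsPotential V) : Continuous (deriv V) :=
  hV.smooth.continuous_deriv (by simp)

lemma IsPotential.deriv_neg (hV : IsPotential V) (r : ℝ) : deriv V (-r) = -deriv V r := by
  have h : (fun x => V (-x)) = V := funext hV.even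
  have := deriv_comp_neg V r
  rw [h] at this
  rw [this, neg_neg]

/-- The growth hypothesis at `x = 1` gives `V r ≥ (a/2) r^k ≥ (a/2) r²` for large `r`, as `k ≥ 2`.
Compactness covers bounded `r ≥ 0`, and evenness the negative half-line. -/
lemma IsPotential.exists_quadratic_le (hV : IsPotential V) :
    ∃ c C : ℝ, 0 < c ∧ ∀ r, c * r ^ 2 - C ≤ V r := by
  obtain ⟨k, a, hk, ha, hlim, -⟩ := hV.growth
  have h1 := hlim 1
  simp only [mul_one, abs_one, Real.one_rpow] at h1
  obtain ⟨R, hR⟩ := eventually_atTop.1 (h1.eventually (lt_mem_nhds (half_lt_self ha)))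
  set S := max R 1
  obtain ⟨m, hm⟩ := (isCompact_Icc (a := (0 : ℝ)) (b := S)).bddBelow_image
    hV.differentiable.continuous.continuousOn
  have hS : 1 ≤ S := le_max_right _ _
  have hpos : ∀ r : ℝ, 0 ≤ r → a / 2 * r ^ 2 - (a / 2 * S ^ 2 + |m|) ≤ V r := by
    intro r hr
    rcases le_total r S with h | h
    · have h2 : m ≤ V r := hm ⟨r, ⟨hr, h⟩, rfl⟩
      have h3 : r ^ 2 ≤ S ^ 2 := pow_le_pow_left₀ hr h 2
      have h4 := neg_abs_le m
      nlinarith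
    · have h2 := hR r ((le_max_left _ _).trans h)
      have hr0 : 0 < r := by linarith
      rw [Real.rpow_neg hr0.le, ← div_eq_inv_mul, lt_div_iff₀ (by positivity)] at h2
      have h3 : r ^ (2 : ℝ) ≤ r ^ k := Real.rpow_le_rpow_of_exponent_le (by linarith) hk
      rw [Real.rpow_two] at h3
      have h4 := abs_nonneg m
      have h5 : a / 2 * r ^ 2 ≤ a / 2 * r ^ k := by gcongr
      have h6 : 0 ≤ a / 2 * S ^ 2 := by positivity
      linarith
  refine ⟨a / 2, a / 2 * S ^ 2 + |m|, by positivity, fun r => ?_⟩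
  rcases le_total 0 r with h | h
  · exact hpos r h
  · have := hpos (-r) (by linarith)
    rwa [hV.even, neg_sq] at this

lemma IsPotential.exists_deriv_le (hV : IsPotential V) :
    ∃ (n : ℕ) (C : ℝ), ∀ r, |deriv V r| ≤ C + C * |r| ^ n := by
  obtain ⟨k, a, hk, ha, -, hlim⟩ := hV.growth
  have h1 := hlim 1
  simp only [mul_one, abs_one, Real.one_rpow, Real.sign_one] at h1
  have h1' := h1.abs
  obtain ⟨R, hR⟩ := eventually_atTop.1 (h1'.eventually (gt_mem_nhds (lt_add_one _)))
  set B := |k * a| + 1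
  set S := max R 1
  obtain ⟨m, hm⟩ := (isCompact_Icc (a := (0 : ℝ)) (b := S)).bddAbove_image
    hV.continuous_deriv.abs.continuousOn
  have hS : 1 ≤ S := le_max_right _ _
  have hB : 0 ≤ B := by positivity
  -- `k` is real; rounding `k - 1` up to a natural power costs nothing for `r ≥ 1`.
  set n := ⌈k - 1⌉₊
  have hpos : ∀ r : ℝ, 0 ≤ r → |deriv V r| ≤ (B + |m|) + (B + |m|) * |r| ^ n := by
    intro r hr
    have h0 := abs_nonneg m
    rcases le_total r S with h | h
    · have h2 : |deriv V r| ≤ m := hm ⟨r, ⟨hr, h⟩, rfl⟩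
      have h4 := le_abs_self m
      have h5 : 0 ≤ (B + |m|) * |r| ^ n := by positivity
      linarith
    · have h2 := hR r ((le_max_left _ _).trans h)
      have hr0 : 0 < r := by linarith
      have e : (1 : ℝ) - k = -(k - 1) := by ring
      rw [abs_mul, abs_of_pos (by positivity), e, Real.rpow_neg hr0.le, ← div_eq_inv_mul,
        div_lt_iff₀ (by positivity)] at h2
      have h3 : r ^ (k - 1) ≤ r ^ n := by
        rw [← Real.rpow_natCast]
        exact Real.rpow_le_rpow_of_exponent_le (by linarith) (Nat.le_ceil _)
      rw [abs_of_pos hr0]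
      have h5 : B * r ^ (k - 1) ≤ B * r ^ n := by gcongr
      have h6 : 0 ≤ |m| * r ^ n := by positivity
      change |deriv V r| < B * r ^ (k - 1) at h2
      linarith
  refine ⟨n, B + |m|, fun r => ?_⟩
  rcases le_total 0 r with h | h
  · exact hpos r h
  · have := hpos (-r) (by linarith)
    rwa [hV.deriv_neg, abs_neg, abs_neg] at this

/-- Completing the square absorbs the tension term `τ r` into half of the quadratic lower bound on
`V`. -/
lemma IsPotential.exists_weight_le (hV : IsPotential V) (τ : ℝ) (hT : 0 < T) :
    ∃ b C : ℝ, 0 < b ∧ ∀ r, Real.exp (-(V r - τ * r) / T) ≤ C * Real.exp (-b * r ^ 2) := by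
  obtain ⟨c, C, hc, h⟩ := hV.exists_quadratic_le
  refine ⟨c / (2 * T), Real.exp ((C + τ ^ 2 / (2 * c)) / T), by positivity, fun r => ?_⟩
  rw [← Real.exp_add, Real.exp_le_exp]
  have e : (C + τ ^ 2 / (2 * c)) / T + -(c / (2 * T)) * r ^ 2 =
      (C + τ ^ 2 / (2 * c) - c / 2 * r ^ 2) / T := by
    field_simp
    ring
  rw [e]
  refine div_le_div_of_nonneg_right ?_ hT.le
  have h1 := h r
  have h2 : τ * r ≤ c / 2 * r ^ 2 + τ ^ 2 / (2 * c) := by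
    have : c / 2 * r ^ 2 + τ ^ 2 / (2 * c) - τ * r = (c * r - τ) ^ 2 / (2 * c) := by
      field_simp
      ring
    have h3 : 0 ≤ (c * r - τ) ^ 2 / (2 * c) := by positivity
    linarith
  linarith

lemma IsPotential.continuous_weight (hV : IsPotential V) :
    Continuous fun r => Real.exp (-(V r - τ * r) / T) := by
  have := hV.differentiable.continuous
  fun_prop

lemma IsPotential.integrable_weight (hV : IsPotential V) (τ : ℝ) (hT : 0 < T) :
    Integrable fun r => Real.exp (-(V r - τ * r) / T) := by
  obtain ⟨b, C, hb, h⟩ := hV.exists_weight_le τ hT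
  refine ((integrable_exp_neg_mul_sq hb).const_mul C).mono'
    hV.continuous_weight.aestronglyMeasurable (Eventually.of_forall fun r => ?_)
  rw [Real.norm_eq_abs, Real.abs_exp]
  exact h r

lemma IsPotential.isProbabilityMeasure_tilted (hV : IsPotential V) (τ : ℝ) (hT : 0 < T) :
    IsProbabilityMeasure (volume.tilted fun r => -(V r - τ * r) / T) :=
  MeasureTheory.isProbabilityMeasure_tilted (hV.integrable_weight τ hT)

/-- A polynomially bounded function against a weight with Gaussian decay. -/
lemma IsPotential.memLp_deriv (hV : IsPotential V) (τ : ℝ) (hT : 0 < T) :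
    MemLp (deriv V) 2 (volume.tilted fun r => -(V r - τ * r) / T) := by
  rw [memLp_two_iff_integrable_sq hV.continuous_deriv.aestronglyMeasurable,
    integrable_tilted_iff (hV.integrable_weight τ hT)]
  obtain ⟨b, C, hb, h⟩ := hV.exists_weight_le τ hT
  obtain ⟨n, D, hD⟩ := hV.exists_deriv_le
  have hpow : Integrable fun r : ℝ => r ^ (2 * n) * Real.exp (-b * r ^ 2) := by
    have := integrable_rpow_mul_exp_neg_mul_sq hb (s := (2 * n : ℕ))
      (by have : (0 : ℝ) ≤ (2 * n : ℕ) := Nat.cast_nonneg _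
          linarith)
    simpa only [Real.rpow_natCast] using this
  have hdom := (((integrable_exp_neg_mul_sq hb).add hpow).const_mul (2 * D ^ 2)).const_mul C
  refine hdom.mono' (hV.continuous_weight.smul
    (hV.continuous_deriv.pow 2)).aestronglyMeasurable (Eventually.of_forall fun r => ?_)
  rw [norm_smul, Real.norm_eq_abs, Real.abs_exp, Real.norm_eq_abs, abs_pow]
  have h1 : |deriv V r| ^ 2 ≤ 2 * D ^ 2 * (1 + r ^ (2 * n)) := by
    have e : r ^ (2 * n) = (|r| ^ n) ^ 2 := by rw [← pow_mul, mul_comm n, pow_mul, pow_mul, sq_abs]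
    rw [e]
    have := pow_le_pow_left₀ (abs_nonneg _) (hD r) 2
    nlinarith [sq_nonneg (D - D * |r| ^ n)]
  calc Real.exp (-(V r - τ * r) / T) * |deriv V r| ^ 2
      ≤ (C * Real.exp (-b * r ^ 2)) * (2 * D ^ 2 * (1 + r ^ (2 * n))) :=
        mul_le_mul (h r) h1 (by positivity) ((Real.exp_pos _).le.trans (h r))
    _ = _ := by simp only [Pi.add_apply]; ring

/-- The logarithmic derivative of the density of `r`, up to sign. -/
noncomputable def force (V : ℝ → ℝ) (τ T r : ℝ) : ℝ := (deriv V r - τ) / T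

lemma IsPotential.memLp_force (hV : IsPotential V) (τ : ℝ) (hT : 0 < T) :
    MemLp (force V τ T) 2 (volume.tilted fun r => -(V r - τ * r) / T) := by
  have := hV.isProbabilityMeasure_tilted τ hT
  have h := ((hV.memLp_deriv τ hT).sub (memLp_const τ)).const_mul T⁻¹
  refine h.ae_eq (Eventually.of_forall fun r => ?_)
  simp only [Pi.sub_apply, force]
  ring

lemma IsPotential.integral_deriv_tilted (hV : IsPotential V) (τ : ℝ) (hT : 0 < T)
    {φ φ' : ℝ → ℝ} (hφ : ∀ r, HasDerivAt φ (φ' r) r) (hmeas : Measurable φ') {C : ℝ}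
    (hC : ∀ r, |φ r| ≤ C) (hC' : ∀ r, |φ' r| ≤ C) :
    ∫ r, φ' r ∂(volume.tilted fun r => -(V r - τ * r) / T) =
      ∫ r, φ r * force V τ T r ∂(volume.tilted fun r => -(V r - τ * r) / T) := by
  have := hV.isProbabilityMeasure_tilted τ hT
  have hU : ∀ r : ℝ, HasDerivAt (fun r => -(V r - τ * r) / T) (-force V τ T r) r := by
    intro r
    refine ((((hV.differentiable r).hasDerivAt.fun_sub
      ((hasDerivAt_id r).const_mul τ)).fun_neg).div_const T).congr_deriv ?_
    rw [force]
    ring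
  have h := FlipChain.integral_deriv_tilted hU (hV.integrable_weight τ hT)
    ((hV.memLp_force τ hT).integrable one_le_two).neg hφ hmeas hC hC'
  rw [h, ← integral_neg]
  simp

lemma IsPotential.isProbabilityMeasure_siteMeasure (hV : IsPotential V) (τ : ℝ) (hT : 0 < T) :
    IsProbabilityMeasure (siteMeasure V τ T) := by
  have := hV.isProbabilityMeasure_tilted τ hT
  unfold siteMeasure
  infer_instance

end Potential

/-! ### Flips, shifts, reversal and resampling of configurations -/

section Maps

variable {V : ℝ → ℝ} {τ T : ℝ}

/-- Flip of the momenta of the particles in a finite set. -/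
def flipSet (S : Finset ℤ) (ω : Config) : Config :=
  fun x => if x ∈ S then ((ω x).1, -(ω x).2) else ω x

lemma flipAt_apply (x z : ℤ) (ω : Config) :
    flipAt x ω z = if z = x then ((ω z).1, -(ω z).2) else ω z := by
  by_cases h : z = x
  · subst h; simp [flipAt]
  · simp [flipAt, h]

lemma flipAt_flipAt (x : ℤ) (ω : Config) : flipAt x (flipAt x ω) = ω := by
  funext z
  by_cases h : z = x <;> simp [flipAt_apply, h]

lemma flipSet_flipSet (S : Finset ℤ) (ω : Config) : flipSet S (flipSet S ω) = ω := by
  funext z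
  by_cases h : z ∈ S <;> simp [flipSet, h]

lemma flipSet_insert {x : ℤ} {S : Finset ℤ} (hx : x ∉ S) (ω : Config) :
    flipSet (insert x S) ω = flipAt x (flipSet S ω) := by
  funext z
  by_cases h : z = x
  · subst h; simp [flipAt_apply, flipSet, hx]
  · simp [flipAt_apply, flipSet, h]

lemma flipAt_flipSet (x : ℤ) (S : Finset ℤ) (ω : Config) :
    flipAt x (flipSet S ω) = flipSet S (flipAt x ω) := by
  funext z
  by_cases h : z = x
  · subst h
    by_cases h' : z ∈ S <;> simp [flipAt_apply, flipSet, h']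
  · simp [flipAt_apply, flipSet, h]

lemma reverseMomenta_reverseMomenta (ω : Config) : reverseMomenta (reverseMomenta ω) = ω := by
  funext z
  simp [reverseMomenta]

lemma reverseMomenta_shift (x : ℤ) (ω : Config) :
    reverseMomenta (shift x ω) = shift x (reverseMomenta ω) := rfl

lemma reverseMomenta_flipAt (x : ℤ) (ω : Config) :
    reverseMomenta (flipAt x ω) = flipAt x (reverseMomenta ω) := by
  funext z
  by_cases h : z = x <;> simp [flipAt_apply, reverseMomenta, h]

lemma flipAt_shift (x y : ℤ) (ω : Config) :
    flipAt x (shift y ω) = shift y (flipAt (y + x) ω) := by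
  funext z
  simp [flipAt_apply, shift]

lemma shift_update (y x : ℤ) (ω : Config) (z : ℝ × ℝ) :
    shift y (Function.update ω x z) = Function.update (shift y ω) (x - y) z := by
  funext w
  simp only [shift, Function.update_apply]
  by_cases h : w = x - y
  · simp [h]
  · rw [if_neg h, if_neg (by omega)]

lemma reverseMomenta_update (x : ℤ) (ω : Config) (z : ℝ × ℝ) :
    reverseMomenta (Function.update ω x z) =
      Function.update (reverseMomenta ω) x (z.1, -z.2) := by
  funext w
  by_cases h : w = x
  · subst h; simp [reverseMomenta]
  · simp [reverseMomenta, h]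

lemma map_neg_siteMeasure (V : ℝ → ℝ) (τ T : ℝ) :
    (siteMeasure V τ T).map (fun z : ℝ × ℝ => (z.1, -z.2)) = siteMeasure V τ T := by
  have h : MeasurePreserving (fun p : ℝ => -p) (gaussianReal 0 T.toNNReal)
      (gaussianReal 0 T.toNNReal) := ⟨measurable_neg, by rw [gaussianReal_map_neg, neg_zero]⟩
  exact ((MeasurePreserving.id _).prod h).map_eq

lemma integral_comp_of_measurePreserving {φ : Config → Config}
    (hφ : MeasurePreserving φ (gibbs V τ T) (gibbs V τ T)) {F : Config → ℝ} (hF : Measurable F) :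
    ∫ ω, F (φ ω) ∂gibbs V τ T = ∫ ω, F ω ∂gibbs V τ T := by
  conv_rhs => rw [← hφ.map_eq]
  rw [integral_map hφ.measurable.aemeasurable hF.aestronglyMeasurable]

variable [IsProbabilityMeasure (siteMeasure V τ T)]

lemma measurePreserving_coordinatewise (f : ℤ → ℝ × ℝ → ℝ × ℝ)
    (hf : ∀ x, MeasurePreserving (f x) (siteMeasure V τ T) (siteMeasure V τ T)) :
    MeasurePreserving (fun (ω : Config) x => f x (ω x)) (gibbs V τ T) (gibbs V τ T) := by
  refine ⟨measurable_pi_lambda _ fun x => (hf x).measurable.comp (measurable_pi_apply x), ?_⟩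
  rw [gibbs, Measure.infinitePi_map_pi _ fun x => (hf x).measurable]
  congr 1
  funext x
  exact (hf x).map_eq

lemma measurePreserving_flipSet (S : Finset ℤ) :
    MeasurePreserving (flipSet S) (gibbs V τ T) (gibbs V τ T) := by
  refine measurePreserving_coordinatewise
    (fun x z => if x ∈ S then (z.1, -z.2) else z) fun x => ?_
  by_cases h : x ∈ S
  · simp only [h, if_true]
    exact ⟨by fun_prop, map_neg_siteMeasure V τ T⟩
  · simp only [h, if_false]
    exact MeasurePreserving.id _

lemma measurePreserving_flipAt (x : ℤ) :
    MeasurePreserving (flipAt x) (gibbs V τ T) (gibbs V τ T) := by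
  have h : flipAt x = flipSet {x} := by
    funext ω z
    simp [flipAt_apply, flipSet]
  rw [h]
  exact measurePreserving_flipSet {x}

lemma measurePreserving_reverseMomenta :
    MeasurePreserving reverseMomenta (gibbs V τ T) (gibbs V τ T) :=
  measurePreserving_coordinatewise (fun _ z => (z.1, -z.2))
    fun _ => ⟨by fun_prop, map_neg_siteMeasure V τ T⟩

/-- Resampling one site leaves the Gibbs measure invariant. -/
lemma measurePreserving_update (x : ℤ) :
    MeasurePreserving (fun z : Config × (ℝ × ℝ) => Function.update z.1 x z.2)
      ((gibbs V τ T).prod (siteMeasure V τ T)) (gibbs V τ T) := by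
  have hmeas : Measurable (fun z : Config × (ℝ × ℝ) => Function.update z.1 x z.2) := by
    refine measurable_pi_lambda _ fun y => ?_
    by_cases h : y = x
    · subst h
      simpa using measurable_snd
    · simp only [Function.update_of_ne h]
      exact (measurable_pi_apply y).comp measurable_fst
  refine ⟨hmeas, ?_⟩
  -- It suffices to test boxes: the preimage of a box constrains the old configuration off `x` and
  -- the fresh variable at `x`.
  refine Measure.eq_infinitePi _ fun s t ht => ?_
  rw [Measure.map_apply hmeas (.pi s.countable_toSet fun _ _ => ht _)]
  have hpre : (fun z : Config × (ℝ × ℝ) => Function.update z.1 x z.2) ⁻¹' (Set.pi s t) =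
      (Set.pi (s.erase x : Finset ℤ) t) ×ˢ (if x ∈ s then t x else Set.univ) := by
    ext ⟨ω, z⟩
    simp only [Set.mem_preimage, Set.mem_pi, Set.mem_prod, Finset.mem_coe, Finset.mem_erase]
    constructor
    · intro h
      refine ⟨fun y hy => by simpa [hy.1] using h y hy.2, ?_⟩
      split_ifs with hx
      · simpa using h x hx
      · trivial
    · rintro ⟨h1, h2⟩ y hy
      by_cases hyx : y = x
      · subst hyx
        simpa [hy] using h2
      · simpa [hyx] using h1 y ⟨hyx, hy⟩
  rw [hpre, Measure.prod_prod, gibbs, Measure.infinitePi_pi _ fun y _ => ht y]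
  split_ifs with hx
  · rw [mul_comm, Finset.mul_prod_erase s (fun y => siteMeasure V τ T (t y)) hx]
  · rw [measure_univ, mul_one, Finset.erase_eq_of_notMem hx]

end Maps

/-! ### Comparison of a product of flips with the sum of the flips -/

section Local

variable {V : ℝ → ℝ} {τ T : ℝ}

lemma LocalFun.mem (f : LocalFun V τ T) : (f : Config → ℝ) ∈ localSubmodule V τ T := f.2

lemma integrable_mul_of_mem {f g : Config → ℝ} (hf : f ∈ localSubmodule V τ T)
    (hg : g ∈ localSubmodule V τ T) : Integrable (fun ω => f ω * g ω) (gibbs V τ T) :=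
  hf.2.2.integrable_mul hg.2.2

/-- The Dirichlet-type form of a measure preserving involution is subadditive under the
composition of commuting involutions. -/
lemma integral_involution_subadditive {f : Config → ℝ} (hf : f ∈ localSubmodule V τ T)
    {φ ψ : Config → Config} (hφ : MeasurePreserving φ (gibbs V τ T) (gibbs V τ T))
    (hψ : MeasurePreserving ψ (gibbs V τ T) (gibbs V τ T)) (hφφ : ∀ ω, φ (φ ω) = ω)
    (hψψ : ∀ ω, ψ (ψ ω) = ω) (hcomm : ∀ ω, φ (ψ ω) = ψ (φ ω)) :
    (∫ ω, f ω * f ω ∂gibbs V τ T) - ∫ ω, f ω * f (φ (ψ ω)) ∂gibbs V τ T ≤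
      ((∫ ω, f ω * f ω ∂gibbs V τ T) - ∫ ω, f ω * f (φ ω) ∂gibbs V τ T) +
      ((∫ ω, f ω * f ω ∂gibbs V τ T) - ∫ ω, f ω * f (ψ ω) ∂gibbs V τ T) := by
  have hm := hf.1
  have hL := hf.2.2
  have hLφ : MemLp (fun ω => f (φ ω)) 2 (gibbs V τ T) := hL.comp_measurePreserving hφ
  have hLψ : MemLp (fun ω => f (ψ ω)) 2 (gibbs V τ T) := hL.comp_measurePreserving hψ
  have hLφψ : MemLp (fun ω => f (φ (ψ ω))) 2 (gibbs V τ T) := hLφ.comp_measurePreserving hψ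
  have hmφ := hm.comp hφ.measurable
  have hmψ := hm.comp hψ.measurable
  have hmφψ := hmφ.comp hψ.measurable
  have i00 := hL.integrable_mul hL
  have i01 := hL.integrable_mul hLφ
  have i02 := hL.integrable_mul hLψ
  have i03 := hL.integrable_mul hLφψ
  -- `G = f · (1 - φ)(1 - ψ) f`. Summing it over the orbit of the group generated by `φ` and `ψ`
  -- gives the square of `(1 - φ)(1 - ψ) f`, so its integral is nonnegative.
  set G : Config → ℝ := fun ω => f ω * f ω - f ω * f (φ ω) - f ω * f (ψ ω) + f ω * f (φ (ψ ω))
    with hG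
  have hGm : Measurable G :=
    (((hm.mul hm).sub (hm.mul hmφ)).sub (hm.mul hmψ)).add (hm.mul hmφψ)
  have hGi : Integrable G (gibbs V τ T) := ((i00.sub i01).sub i02).add i03
  have hGint : ∫ ω, G ω ∂gibbs V τ T = (∫ ω, f ω * f ω ∂gibbs V τ T) -
      (∫ ω, f ω * f (φ ω) ∂gibbs V τ T) - (∫ ω, f ω * f (ψ ω) ∂gibbs V τ T) +
      ∫ ω, f ω * f (φ (ψ ω)) ∂gibbs V τ T := by
    have h1 := integral_add ((i00.sub i01).sub i02) i03
    have h2 := integral_sub (i00.sub i01) i02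
    have h3 := integral_sub i00 i01
    simp only [Pi.sub_apply, Pi.mul_apply] at h1 h2 h3
    rw [hG, h1, h2, h3]
  have hGφi : Integrable (fun ω => G (φ ω)) (gibbs V τ T) := hφ.integrable_comp_of_integrable hGi
  have hGψi : Integrable (fun ω => G (ψ ω)) (gibbs V τ T) := hψ.integrable_comp_of_integrable hGi
  have hGφψi : Integrable (fun ω => G (φ (ψ ω))) (gibbs V τ T) :=
    hψ.integrable_comp_of_integrable hGφi
  have eφ := integral_comp_of_measurePreserving hφ hGm
  have eψ := integral_comp_of_measurePreserving hψ hGm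
  have eφψ := integral_comp_of_measurePreserving hψ (hGm.comp hφ.measurable)
  simp only [Function.comp] at eφψ
  have hsum : ∫ ω, (G ω + G (φ ω) + G (ψ ω) + G (φ (ψ ω))) ∂gibbs V τ T =
      4 * ∫ ω, G ω ∂gibbs V τ T := by
    have h1 := integral_add ((hGi.add hGφi).add hGψi) hGφψi
    have h2 := integral_add (hGi.add hGφi) hGψi
    have h3 := integral_add hGi hGφi
    simp only [Pi.add_apply] at h1 h2 h3
    rw [h1, h2, h3, eφ, eψ, eφψ, eφ]
    ring
  have hnonneg : 0 ≤ ∫ ω, (G ω + G (φ ω) + G (ψ ω) + G (φ (ψ ω))) ∂gibbs V τ T := by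
    refine integral_nonneg fun ω => ?_
    have e : G ω + G (φ ω) + G (ψ ω) + G (φ (ψ ω)) =
        (f ω - f (φ ω) - f (ψ ω) + f (φ (ψ ω))) ^ 2 := by
      simp only [hG]
      simp only [← hcomm, hφφ, hψψ]
      ring
    simp only [Pi.zero_apply]
    rw [e]
    positivity
  rw [hsum, hGint] at hnonneg
  linarith

variable [IsProbabilityMeasure (siteMeasure V τ T)]

lemma comp_shift_mem {f : Config → ℝ} (hf : f ∈ localSubmodule V τ T) (y : ℤ) :
    (fun ω => f (shift y ω)) ∈ localSubmodule V τ T := by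
  obtain ⟨hm, ⟨Λ, hΛ⟩, hL⟩ := hf
  refine ⟨hm.comp (measurable_shift y), ⟨Λ.image fun z => y + z, fun ω ω' h => ?_⟩,
    hL.comp_measurePreserving (measurePreserving_shift y)⟩
  refine hΛ fun i hi => h (y + i) ?_
  simpa using hi

lemma comp_flipAt_mem {f : Config → ℝ} (hf : f ∈ localSubmodule V τ T) (x : ℤ) :
    (fun ω => f (flipAt x ω)) ∈ localSubmodule V τ T := by
  obtain ⟨hm, ⟨Λ, hΛ⟩, hL⟩ := hf
  refine ⟨hm.comp (measurePreserving_flipAt (V := V) (τ := τ) (T := T) x).measurable,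
    ⟨Λ, fun ω ω' h => ?_⟩, hL.comp_measurePreserving (measurePreserving_flipAt x)⟩
  refine hΛ fun i hi => ?_
  rw [flipAt_apply, flipAt_apply, h i hi]

lemma comp_reverseMomenta_mem {f : Config → ℝ} (hf : f ∈ localSubmodule V τ T) :
    (fun ω => f (reverseMomenta ω)) ∈ localSubmodule V τ T := by
  obtain ⟨hm, ⟨Λ, hΛ⟩, hL⟩ := hf
  refine ⟨hm.comp (measurePreserving_reverseMomenta (V := V) (τ := τ) (T := T)).measurable,
    ⟨Λ, fun ω ω' h => ?_⟩, hL.comp_measurePreserving measurePreserving_reverseMomenta⟩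
  refine hΛ fun i hi => ?_
  simp [reverseMomenta, h i hi]

/-- Iterates the subadditivity over the sites of `S`: no factor depending on the size of `S`
appears, which is what makes the gap uniform in the support. -/
lemma integral_flipSet_le {f : Config → ℝ} (hf : f ∈ localSubmodule V τ T) (S : Finset ℤ) :
    (∫ ω, f ω * f ω ∂gibbs V τ T) - ∫ ω, f ω * f (flipSet S ω) ∂gibbs V τ T ≤
      ∑ x ∈ S, ((∫ ω, f ω * f ω ∂gibbs V τ T) - ∫ ω, f ω * f (flipAt x ω) ∂gibbs V τ T) := by
  induction S using Finset.induction_on with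
  | empty =>
    have h : ∀ ω, flipSet ∅ ω = ω := fun ω => by funext z; simp [flipSet]
    simp [h]
  | insert x S hx ih =>
    rw [Finset.sum_insert hx]
    simp_rw [flipSet_insert hx]
    refine (integral_involution_subadditive hf (measurePreserving_flipAt x)
      (measurePreserving_flipSet S) (flipAt_flipAt x) (flipSet_flipSet S)
      (flipAt_flipSet x S)).trans ?_
    linarith

end Local

/-! ### Symmetry and spectral gap of the noise -/

section Noise

variable {V : ℝ → ℝ} {τ T : ℝ}

lemma noise_eq_sum {f : Config → ℝ} {Λ : Finset ℤ} (hΛ : DependsOn f (Λ : Set ℤ)) (ω : Config) :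
    noise f ω = ∑ x ∈ Λ, (f (flipAt x ω) - f ω) := by
  refine finsum_eq_sum_of_support_subset _ fun x hx => ?_
  by_contra h
  refine hx (sub_eq_zero.2 (hΛ fun z hz => ?_))
  rw [flipAt_apply, if_neg]
  rintro rfl
  exact h hz

lemma noise_shift (f : Config → ℝ) (y : ℤ) (ω : Config) :
    noise (fun ω => f (shift y ω)) ω = noise f (shift y ω) := by
  unfold noise
  rw [← finsum_comp_equiv (Equiv.addLeft y)]
  simp [flipAt_shift]

lemma noise_reverseMomenta (f : Config → ℝ) (ω : Config) :
    noise (fun ω => f (reverseMomenta ω)) ω = noise f (reverseMomenta ω) := by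
  unfold noise
  simp [reverseMomenta_flipAt]

lemma noise_sum {ι : Type*} (I : Finset ι) {f : ι → Config → ℝ}
    (hf : ∀ i, ∃ Λ : Finset ℤ, DependsOn (f i) (Λ : Set ℤ)) (ω : Config) :
    noise (fun ω => ∑ i ∈ I, f i ω) ω = ∑ i ∈ I, noise (f i) ω := by
  classical
  choose Λ hΛ using hf
  set S := I.biUnion Λ
  have hS : ∀ i ∈ I, DependsOn (f i) (S : Set ℤ) := fun i hi =>
    (hΛ i).mono (by exact_mod_cast Finset.subset_biUnion_of_mem Λ hi)
  have hsum : DependsOn (fun ω => ∑ i ∈ I, f i ω) (S : Set ℤ) := fun ω ω' h =>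
    Finset.sum_congr rfl fun i hi => hS i hi h
  rw [noise_eq_sum hsum, Finset.sum_congr rfl fun i hi => noise_eq_sum (hS i hi) ω,
    Finset.sum_comm]
  simp

lemma integral_sum_sub {ι : Type*} (I : Finset ι) {F : ι → Config → ℝ} {G : Config → ℝ}
    (hF : ∀ i, Integrable (F i) (gibbs V τ T)) (hG : Integrable G (gibbs V τ T)) :
    ∫ ω, ∑ i ∈ I, (F i ω - G ω) ∂gibbs V τ T =
      ∑ i ∈ I, ((∫ ω, F i ω ∂gibbs V τ T) - ∫ ω, G ω ∂gibbs V τ T) := by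
  have h : ∀ i ∈ I, Integrable (fun ω => F i ω - G ω) (gibbs V τ T) := fun i _ => (hF i).sub hG
  rw [integral_finsetSum _ h]
  exact Finset.sum_congr rfl fun i _ => integral_sub (hF i) hG

variable [IsProbabilityMeasure (siteMeasure V τ T)]

lemma noise_mem {f : Config → ℝ} (hf : f ∈ localSubmodule V τ T) :
    noise f ∈ localSubmodule V τ T := by
  obtain ⟨Λ, hΛ⟩ := hf.2.1
  have h : noise f = ∑ x ∈ Λ, ((fun ω => f (flipAt x ω)) - f) := by
    funext ω
    rw [noise_eq_sum hΛ, Finset.sum_apply]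
    rfl
  rw [h]
  exact Submodule.sum_mem _ fun x _ => Submodule.sub_mem _ (comp_flipAt_mem hf x) hf

/-- Each flip is a measure preserving involution, hence self-adjoint in `L²(μ)`. -/
lemma integral_noise_mul {f h : Config → ℝ} (hf : f ∈ localSubmodule V τ T)
    (hh : h ∈ localSubmodule V τ T) :
    ∫ ω, noise f ω * h ω ∂gibbs V τ T = ∫ ω, f ω * noise h ω ∂gibbs V τ T := by
  obtain ⟨Λ, hΛ⟩ := hf.2.1
  obtain ⟨Λ', hΛ'⟩ := hh.2.1
  have h1 : DependsOn f ((Λ ∪ Λ' : Finset ℤ) : Set ℤ) := hΛ.mono (by simp)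
  have h2 : DependsOn h ((Λ ∪ Λ' : Finset ℤ) : Set ℤ) := hΛ'.mono (by simp)
  simp_rw [noise_eq_sum h1, noise_eq_sum h2, Finset.sum_mul, Finset.mul_sum, sub_mul, mul_sub]
  rw [integral_sum_sub _ (fun x => integrable_mul_of_mem (comp_flipAt_mem hf x) hh)
      (integrable_mul_of_mem hf hh),
    integral_sum_sub _ (fun x => integrable_mul_of_mem hf (comp_flipAt_mem hh x))
      (integrable_mul_of_mem hf hh)]
  refine Finset.sum_congr rfl fun x _ => ?_
  congr 1
  have e := integral_comp_of_measurePreserving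
    (measurePreserving_flipAt (V := V) (τ := τ) (T := T) x)
    (hf.1.mul (comp_flipAt_mem hh x).1)
  simpa [flipAt_flipAt] using e

lemma integral_noise {f : Config → ℝ} (hf : f ∈ localSubmodule V τ T) :
    ∫ ω, noise f ω ∂gibbs V τ T = 0 := by
  have h1 : (fun _ => 1 : Config → ℝ) ∈ localSubmodule V τ T :=
    ⟨measurable_const, ⟨∅, fun _ _ _ => rfl⟩, memLp_const 1⟩
  have h := integral_noise_mul hf h1
  simpa [noise] using h

/-- Spectral gap of the noise on functions antisymmetric in the momenta. -/
lemma integral_mul_noise_le {f : Config → ℝ} (hf : f ∈ localSubmodule V τ T) :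
    ∫ ω, f ω * noise f ω ∂gibbs V τ T ≤
      (∫ ω, f ω * f (reverseMomenta ω) ∂gibbs V τ T) - ∫ ω, f ω * f ω ∂gibbs V τ T := by
  obtain ⟨Λ, hΛ⟩ := hf.2.1
  -- On a function supported in `Λ`, full reversal is the product of the flips over `Λ`.
  have h1 : ∀ ω, f (reverseMomenta ω) = f (flipSet Λ ω) := fun ω => hΛ fun i hi => by
    have : i ∈ Λ := hi
    simp [reverseMomenta, flipSet, this]
  have h2 := integral_flipSet_le hf Λ
  simp_rw [h1, noise_eq_sum hΛ, Finset.mul_sum, mul_sub]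
  rw [integral_sum_sub _ (fun x => integrable_mul_of_mem hf (comp_flipAt_mem hf x))
      (integrable_mul_of_mem hf hf)]
  have h3 := Finset.sum_neg_distrib (s := Λ) fun x =>
    (∫ ω, f ω * f ω ∂gibbs V τ T) - ∫ ω, f ω * f (flipAt x ω) ∂gibbs V τ T
  simp only [neg_sub] at h3
  rw [h3]
  linarith

end Noise

/-! ### Smooth local functions -/

/-- Bounded functions of finitely many coordinates with bounded measurable partial derivatives. -/
structure IsSmoothLocal (f : Config → ℝ) : Prop where
  measurable : Measurable f
  dependsOn : ∃ Λ : Finset ℤ, DependsOn f (Λ : Set ℤ)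
  bounded : ∃ C, ∀ ω, |f ω| ≤ C ∧ ∀ x, |partialR x f ω| ≤ C ∧ |partialP x f ω| ≤ C
  measurable_partialR : ∀ x, Measurable (partialR x f)
  measurable_partialP : ∀ x, Measurable (partialP x f)
  diffR : ∀ x ω p, Differentiable ℝ fun s => f (Function.update ω x (s, p))
  diffP : ∀ x ω r, Differentiable ℝ fun s => f (Function.update ω x (r, s))

section SmoothLocal

lemma partialR_update (x : ℤ) (f : Config → ℝ) (ω : Config) (r p : ℝ) :
    partialR x f (Function.update ω x (r, p)) =
      deriv (fun s => f (Function.update ω x (s, p))) r := by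
  simp [partialR]

lemma partialP_update (x : ℤ) (f : Config → ℝ) (ω : Config) (r p : ℝ) :
    partialP x f (Function.update ω x (r, p)) =
      deriv (fun s => f (Function.update ω x (r, s))) p := by
  simp [partialP]

lemma partialR_eq_zero {f : Config → ℝ} {Λ : Finset ℤ} (hΛ : DependsOn f (Λ : Set ℤ)) {x : ℤ}
    (hx : x ∉ Λ) (ω : Config) : partialR x f ω = 0 := by
  have h : (fun s => f (Function.update ω x (s, (ω x).2))) = fun _ => f ω := by
    funext s
    refine hΛ fun i hi => Function.update_of_ne ?_ _ _
    rintro rfl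
    exact hx hi
  rw [partialR, h, deriv_const]

lemma partialP_eq_zero {f : Config → ℝ} {Λ : Finset ℤ} (hΛ : DependsOn f (Λ : Set ℤ)) {x : ℤ}
    (hx : x ∉ Λ) (ω : Config) : partialP x f ω = 0 := by
  have h : (fun s => f (Function.update ω x ((ω x).1, s))) = fun _ => f ω := by
    funext s
    refine hΛ fun i hi => Function.update_of_ne ?_ _ _
    rintro rfl
    exact hx hi
  rw [partialP, h, deriv_const]

lemma partialR_mul {f g : Config → ℝ} (hf : IsSmoothLocal f) (hg : IsSmoothLocal g) (x : ℤ)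
    (ω : Config) : partialR x (fun ω => f ω * g ω) ω =
      partialR x f ω * g ω + f ω * partialR x g ω := by
  unfold partialR
  rw [deriv_fun_mul (hf.diffR x ω _ _) (hg.diffR x ω _ _)]
  simp

lemma partialP_mul {f g : Config → ℝ} (hf : IsSmoothLocal f) (hg : IsSmoothLocal g) (x : ℤ)
    (ω : Config) : partialP x (fun ω => f ω * g ω) ω =
      partialP x f ω * g ω + f ω * partialP x g ω := by
  unfold partialP
  rw [deriv_fun_mul (hf.diffP x ω _ _) (hg.diffP x ω _ _)]
  simp

lemma partialR_shift (f : Config → ℝ) (x y : ℤ) (ω : Config) :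
    partialR x (fun ω => f (shift y ω)) ω = partialR (x - y) f (shift y ω) := by
  unfold partialR
  simp [shift_update, shift]

lemma partialP_shift (f : Config → ℝ) (x y : ℤ) (ω : Config) :
    partialP x (fun ω => f (shift y ω)) ω = partialP (x - y) f (shift y ω) := by
  unfold partialP
  simp [shift_update, shift]

lemma partialR_reverseMomenta (f : Config → ℝ) (x : ℤ) (ω : Config) :
    partialR x (fun ω => f (reverseMomenta ω)) ω = partialR x f (reverseMomenta ω) := by
  unfold partialR
  simp [reverseMomenta_update, reverseMomenta]

lemma partialP_reverseMomenta (f : Config → ℝ) (x : ℤ) (ω : Config) :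
    partialP x (fun ω => f (reverseMomenta ω)) ω = -partialP x f (reverseMomenta ω) := by
  unfold partialP
  simp only [reverseMomenta_update]
  exact deriv_comp_neg (fun s => f (Function.update (reverseMomenta ω) x ((ω x).1, s))) (ω x).2

lemma measurable_reverseMomenta : Measurable reverseMomenta := by
  refine measurable_pi_lambda _ fun x => ?_
  simp only [reverseMomenta]
  fun_prop

lemma IsSmoothLocal.mul {f g : Config → ℝ} (hf : IsSmoothLocal f) (hg : IsSmoothLocal g) :
    IsSmoothLocal fun ω => f ω * g ω where
  measurable := hf.measurable.mul hg.measurable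
  dependsOn := by
    obtain ⟨Λ, hΛ⟩ := hf.dependsOn
    obtain ⟨Λ', hΛ'⟩ := hg.dependsOn
    refine ⟨Λ ∪ Λ', fun ω ω' h => ?_⟩
    have h1 := hΛ.mono (t := ((Λ ∪ Λ' : Finset ℤ) : Set ℤ)) (by simp) h
    have h2 := hΛ'.mono (t := ((Λ ∪ Λ' : Finset ℤ) : Set ℤ)) (by simp) h
    simp only [h1, h2]
  bounded := by
    obtain ⟨C, hC⟩ := hf.bounded
    obtain ⟨D, hD⟩ := hg.bounded
    have hC0 : 0 ≤ C := (abs_nonneg _).trans (hC 0).1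
    have hD0 : 0 ≤ D := (abs_nonneg _).trans (hD 0).1
    have key : ∀ a b : ℝ, |a| ≤ C → |b| ≤ D → |a * b| ≤ C * D := fun a b ha hb => by
      rw [abs_mul]
      exact mul_le_mul ha hb (abs_nonneg _) hC0
    refine ⟨C * D + C * D, fun ω => ⟨?_, fun x => ⟨?_, ?_⟩⟩⟩
    · have := key _ _ (hC ω).1 (hD ω).1
      have : 0 ≤ C * D := by positivity
      linarith
    · rw [partialR_mul hf hg]
      exact (abs_add_le _ _).trans (add_le_add (key _ _ ((hC ω).2 x).1 (hD ω).1)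
        (key _ _ (hC ω).1 ((hD ω).2 x).1))
    · rw [partialP_mul hf hg]
      exact (abs_add_le _ _).trans (add_le_add (key _ _ ((hC ω).2 x).2 (hD ω).1)
        (key _ _ (hC ω).1 ((hD ω).2 x).2))
  measurable_partialR x := by
    rw [funext (partialR_mul hf hg x)]
    exact ((hf.measurable_partialR x).mul hg.measurable).add
      (hf.measurable.mul (hg.measurable_partialR x))
  measurable_partialP x := by
    rw [funext (partialP_mul hf hg x)]
    exact ((hf.measurable_partialP x).mul hg.measurable).add
      (hf.measurable.mul (hg.measurable_partialP x))
  diffR x ω p := (hf.diffR x ω p).mul (hg.diffR x ω p)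
  diffP x ω r := (hf.diffP x ω r).mul (hg.diffP x ω r)

lemma IsSmoothLocal.comp_shift {f : Config → ℝ} (hf : IsSmoothLocal f) (y : ℤ) :
    IsSmoothLocal fun ω => f (shift y ω) where
  measurable := hf.measurable.comp (measurable_shift y)
  dependsOn := by
    obtain ⟨Λ, hΛ⟩ := hf.dependsOn
    refine ⟨Λ.image fun z => y + z, fun ω ω' h => hΛ fun i hi => h (y + i) ?_⟩
    simpa using hi
  bounded := by
    obtain ⟨C, hC⟩ := hf.bounded
    refine ⟨C, fun ω => ⟨(hC _).1, fun x => ?_⟩⟩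
    rw [partialR_shift, partialP_shift]
    exact (hC _).2 _
  measurable_partialR x := by
    rw [funext (partialR_shift f x y)]
    exact (hf.measurable_partialR _).comp (measurable_shift y)
  measurable_partialP x := by
    rw [funext (partialP_shift f x y)]
    exact (hf.measurable_partialP _).comp (measurable_shift y)
  diffR x ω p := by
    simp only [shift_update]
    exact hf.diffR _ _ p
  diffP x ω r := by
    simp only [shift_update]
    exact hf.diffP _ _ r

lemma IsSmoothLocal.comp_reverseMomenta {f : Config → ℝ} (hf : IsSmoothLocal f) :
    IsSmoothLocal fun ω => f (reverseMomenta ω) where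
  measurable := hf.measurable.comp measurable_reverseMomenta
  dependsOn := by
    obtain ⟨Λ, hΛ⟩ := hf.dependsOn
    exact ⟨Λ, fun ω ω' h => hΛ fun i hi => by simp [reverseMomenta, h i hi]⟩
  bounded := by
    obtain ⟨C, hC⟩ := hf.bounded
    refine ⟨C, fun ω => ⟨(hC _).1, fun x => ?_⟩⟩
    rw [partialR_reverseMomenta, partialP_reverseMomenta, abs_neg]
    exact (hC _).2 _
  measurable_partialR x := by
    rw [funext (partialR_reverseMomenta f x)]
    exact (hf.measurable_partialR _).comp measurable_reverseMomenta
  measurable_partialP x := by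
    rw [funext (partialP_reverseMomenta f x)]
    exact ((hf.measurable_partialP _).comp measurable_reverseMomenta).neg
  diffR x ω p := by
    simp only [reverseMomenta_update]
    exact hf.diffR _ _ _
  diffP x ω r := by
    simp only [reverseMomenta_update]
    exact (hf.diffP x (reverseMomenta ω) r).comp differentiable_neg

lemma restrict_update {Λ : Finset ℤ} {x : ℤ} (hx : x ∈ Λ) (ω : Config) (z : ℝ × ℝ) :
    (fun y : Λ => Function.update ω x z y) =
      Function.update (fun y : Λ => ω y) (⟨x, hx⟩ : Λ) z := by
  funext y
  by_cases h : y = ⟨x, hx⟩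
  · subst h; simp
  · rw [Function.update_of_ne h, Function.update_of_ne]
    exact fun h' => h (Subtype.ext h')

lemma hasDerivAt_comp_update {ι : Type*} [Fintype ι] [DecidableEq ι] {F : (ι → ℝ × ℝ) → ℝ}
    (hF : ContDiff ℝ 1 F) (η : ι → ℝ × ℝ) (i : ι) {γ : ℝ → ℝ × ℝ} {v : ℝ × ℝ} {s : ℝ}
    (hγ : HasDerivAt γ v s) :
    HasDerivAt (fun t => F (Function.update η i (γ t)))
      (fderiv ℝ F (Function.update η i (γ s)) (Pi.single i v)) s := by
  have h1 : HasDerivAt (fun t => Function.update η i (γ t)) (Pi.single i v) s := by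
    rw [hasDerivAt_pi]
    intro j
    by_cases h : j = i
    · subst h; simpa using hγ
    · simpa [h] using hasDerivAt_const s (η j)
  exact (((hF.differentiable one_ne_zero) _).hasFDerivAt).comp_hasDerivAt s h1

/-- The larger class keeps only what integration by parts needs, and its stability under products,
shifts and reversal can be checked coordinate by coordinate. -/
lemma IsC01.isSmoothLocal {f : Config → ℝ} (hf : IsC01 f) : IsSmoothLocal f := by
  obtain ⟨Λ, F, hF, hsupp, hfF⟩ := hf
  have hdep : DependsOn f (Λ : Set ℤ) := fun ω ω' h => by
    rw [hfF, hfF]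
    congr 1
    funext x
    exact h x x.2
  have hcont := hF.continuous_fderiv one_ne_zero
  obtain ⟨C, hC⟩ := hsupp.exists_bound_of_continuous hF.continuous
  obtain ⟨D, hD⟩ := (hsupp.fderiv (𝕜 := ℝ)).exists_bound_of_continuous hcont
  have hrestr : Measurable fun (ω : Config) (x : Λ) => ω x :=
    measurable_pi_lambda _ fun x => measurable_pi_apply _
  have hR : ∀ (x : ℤ) (hx : x ∈ Λ) (ω : Config), partialR x f ω =
      fderiv ℝ F (fun y : Λ => ω y) (Pi.single (⟨x, hx⟩ : Λ) ((1 : ℝ), (0 : ℝ))) := by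
    intro x hx ω
    have h := (hasDerivAt_comp_update hF (fun y : Λ => ω y) ⟨x, hx⟩
      ((hasDerivAt_id (ω x).1).prodMk (hasDerivAt_const (ω x).1 (ω x).2))).deriv
    rw [partialR]
    simp only [hfF, restrict_update hx]
    simp only [id] at h
    rw [h, ← restrict_update hx]
    simp
  have hP : ∀ (x : ℤ) (hx : x ∈ Λ) (ω : Config), partialP x f ω =
      fderiv ℝ F (fun y : Λ => ω y) (Pi.single (⟨x, hx⟩ : Λ) ((0 : ℝ), (1 : ℝ))) := by
    intro x hx ω
    have h := (hasDerivAt_comp_update hF (fun y : Λ => ω y) ⟨x, hx⟩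
      ((hasDerivAt_const (ω x).2 (ω x).1).prodMk (hasDerivAt_id (ω x).2))).deriv
    rw [partialP]
    simp only [hfF, restrict_update hx]
    simp only [id] at h
    rw [h, ← restrict_update hx]
    simp
  have hconst : ∀ (x : ℤ), x ∉ Λ → ∀ (ω : Config) (z : ℝ × ℝ),
      f (Function.update ω x z) = f ω := fun x hx ω z =>
    hdep fun i hi => Function.update_of_ne (by rintro rfl; exact hx hi) _ _
  have hbound : ∀ (i : Λ) (v : ℝ × ℝ) (η : Λ → ℝ × ℝ), ‖v‖ ≤ 1 →
      |fderiv ℝ F η (Pi.single i v)| ≤ max C D := by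
    intro i v η hv
    refine le_trans ?_ (le_max_right _ _)
    refine ((fderiv ℝ F η).le_opNorm _).trans ?_
    have h1 : ‖(Pi.single i v : Λ → ℝ × ℝ)‖ ≤ 1 := by
      rw [Pi.norm_single]
      exact hv
    exact (mul_le_of_le_one_right (norm_nonneg _) h1).trans (hD η)
  have hmax : 0 ≤ max C D := (norm_nonneg _).trans ((hC 0).trans (le_max_left _ _))
  refine ⟨?_, ⟨Λ, hdep⟩, ⟨max C D, fun ω => ⟨?_, fun x => ?_⟩⟩, fun x => ?_, fun x => ?_,
    fun x ω p => ?_, fun x ω r => ?_⟩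
  · rw [funext hfF]
    exact hF.continuous.measurable.comp hrestr
  · rw [hfF]
    exact (hC _).trans (le_max_left _ _)
  · by_cases hx : x ∈ Λ
    · rw [hR x hx, hP x hx]
      exact ⟨hbound _ _ _ (by simp [Prod.norm_def]), hbound _ _ _ (by simp [Prod.norm_def])⟩
    · rw [partialR_eq_zero hdep hx, partialP_eq_zero hdep hx]
      simpa using hmax
  · by_cases hx : x ∈ Λ
    · rw [funext (hR x hx)]
      exact (hcont.clm_apply continuous_const).measurable.comp hrestr
    · rw [funext (partialR_eq_zero hdep hx)]
      exact measurable_const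
  · by_cases hx : x ∈ Λ
    · rw [funext (hP x hx)]
      exact (hcont.clm_apply continuous_const).measurable.comp hrestr
    · rw [funext (partialP_eq_zero hdep hx)]
      exact measurable_const
  · by_cases hx : x ∈ Λ
    · simp only [hfF, restrict_update hx]
      exact fun s => (hasDerivAt_comp_update hF (fun y : Λ => ω y) ⟨x, hx⟩
        ((hasDerivAt_id s).prodMk (hasDerivAt_const s p))).differentiableAt
    · simp only [hconst x hx]
      exact differentiable_const _
  · by_cases hx : x ∈ Λ
    · simp only [hfF, restrict_update hx]
      exact fun s => (hasDerivAt_comp_update hF (fun y : Λ => ω y) ⟨x, hx⟩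
        ((hasDerivAt_const s r).prodMk (hasDerivAt_id s))).differentiableAt
    · simp only [hconst x hx]
      exact differentiable_const _

lemma IsSmoothLocal.mem {V : ℝ → ℝ} {τ T : ℝ} [IsProbabilityMeasure (siteMeasure V τ T)]
    {f : Config → ℝ} (hf : IsSmoothLocal f) : f ∈ localSubmodule V τ T := by
  obtain ⟨C, hC⟩ := hf.bounded
  exact ⟨hf.measurable, hf.dependsOn,
    MemLp.of_bound hf.measurable.aestronglyMeasurable C (Eventually.of_forall fun ω => (hC ω).1)⟩

end SmoothLocal

/-! ### The Liouville operator and invariance of the Gibbs measure -/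

section Liouville

variable {V : ℝ → ℝ} {τ T : ℝ}

/-- The contribution of the particle `x` to the Liouville operator. -/
noncomputable def liouvilleAt (V : ℝ → ℝ) (x : ℤ) (f : Config → ℝ) (ω : Config) : ℝ :=
  ((ω x).2 - (ω (x - 1)).2) * partialR x f ω +
    (deriv V (ω (x + 1)).1 - deriv V (ω x).1) * partialP x f ω

lemma liouvilleAt_eq_zero {f : Config → ℝ} {Λ : Finset ℤ} (hΛ : DependsOn f (Λ : Set ℤ)) {x : ℤ}
    (hx : x ∉ Λ) (ω : Config) : liouvilleAt V x f ω = 0 := by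
  rw [liouvilleAt, partialR_eq_zero hΛ hx, partialP_eq_zero hΛ hx]
  simp

lemma liouville_eq_sum {f : Config → ℝ} {Λ : Finset ℤ} (hΛ : DependsOn f (Λ : Set ℤ))
    (ω : Config) : liouville V f ω = ∑ x ∈ Λ, liouvilleAt V x f ω := by
  refine finsum_eq_sum_of_support_subset _ fun x hx => ?_
  by_contra h
  exact hx (liouvilleAt_eq_zero hΛ h ω)

lemma liouville_mul {f g : Config → ℝ} (hf : IsSmoothLocal f) (hg : IsSmoothLocal g)
    (ω : Config) : liouville V (fun ω => f ω * g ω) ω =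
      liouville V f ω * g ω + f ω * liouville V g ω := by
  obtain ⟨Λ, hΛ⟩ := hf.dependsOn
  obtain ⟨Λ', hΛ'⟩ := hg.dependsOn
  have h1 : DependsOn f ((Λ ∪ Λ' : Finset ℤ) : Set ℤ) := hΛ.mono (by simp)
  have h2 : DependsOn g ((Λ ∪ Λ' : Finset ℤ) : Set ℤ) := hΛ'.mono (by simp)
  have h3 : DependsOn (fun ω => f ω * g ω) ((Λ ∪ Λ' : Finset ℤ) : Set ℤ) := fun ω ω' h => by
    simp only [h1 h, h2 h]
  rw [liouville_eq_sum h1, liouville_eq_sum h2, liouville_eq_sum h3, Finset.sum_mul,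
    Finset.mul_sum, ← Finset.sum_add_distrib]
  refine Finset.sum_congr rfl fun x _ => ?_
  simp only [liouvilleAt]
  rw [partialR_mul hf hg, partialP_mul hf hg]
  ring

lemma liouville_shift (f : Config → ℝ) (y : ℤ) (ω : Config) :
    liouville V (fun ω => f (shift y ω)) ω = liouville V f (shift y ω) := by
  unfold liouville
  rw [← finsum_comp_equiv (Equiv.addLeft y)]
  simp [partialR_shift, partialP_shift, shift, add_sub_assoc, add_assoc]

/-- Time reversal: every term of the operator contains either one factor `p` or one derivative
`∂_p`, each odd under reversal. -/
lemma liouville_reverseMomenta (f : Config → ℝ) (ω : Config) :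
    liouville V (fun ω => f (reverseMomenta ω)) ω = -liouville V f (reverseMomenta ω) := by
  unfold liouville
  rw [← finsum_neg_distrib]
  refine finsum_congr fun x => ?_
  rw [partialR_reverseMomenta, partialP_reverseMomenta]
  simp only [reverseMomenta]
  ring

/-- Two integrable functions have the same integral if they have the same integrals over the
variables of one site. -/
lemma integral_congr_site [IsProbabilityMeasure (siteMeasure V τ T)] (x : ℤ) {F G : Config → ℝ}
    (hF : Integrable F (gibbs V τ T)) (hG : Integrable G (gibbs V τ T))
    (h : ∀ ω, Integrable (fun z => F (Function.update ω x z)) (siteMeasure V τ T) →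
      Integrable (fun z => G (Function.update ω x z)) (siteMeasure V τ T) →
      ∫ z, F (Function.update ω x z) ∂siteMeasure V τ T =
        ∫ z, G (Function.update ω x z) ∂siteMeasure V τ T) :
    ∫ ω, F ω ∂gibbs V τ T = ∫ ω, G ω ∂gibbs V τ T := by
  have hu := measurePreserving_update (V := V) (τ := τ) (T := T) x
  have key : ∀ H : Config → ℝ, Integrable H (gibbs V τ T) → ∫ ω, H ω ∂gibbs V τ T =
      ∫ ω, ∫ z, H (Function.update ω x z) ∂siteMeasure V τ T ∂gibbs V τ T := by
    intro H hH
    rw [← integral_prod (fun z : Config × (ℝ × ℝ) => H (Function.update z.1 x z.2))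
      (hu.integrable_comp_of_integrable hH)]
    conv_lhs => rw [← hu.map_eq]
    rw [integral_map hu.measurable.aemeasurable]
    rw [hu.map_eq]
    exact hH.aestronglyMeasurable
  rw [key F hF, key G hG]
  refine integral_congr_ae ?_
  filter_upwards [(hu.integrable_comp_of_integrable hF).prod_right_ae,
    (hu.integrable_comp_of_integrable hG).prod_right_ae] with ω h1 h2
  exact h ω h1 h2

lemma integrable_mul_bounded {G f : Config → ℝ} (hG : Integrable G (gibbs V τ T))
    (hf : Measurable f) {C : ℝ} (hC : ∀ ω, |f ω| ≤ C) :
    Integrable (fun ω => G ω * f ω) (gibbs V τ T) :=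
  hG.mul_bdd (c := C) hf.aestronglyMeasurable (Eventually.of_forall hC)

/-- Integration by parts in the variable `r_x`. -/
lemma integral_mul_partialR (hV : IsPotential V) (hT : 0 < T) (τ : ℝ)
    {f G : Config → ℝ} (hf : IsSmoothLocal f) (x : ℤ)
    (hG : Integrable G (gibbs V τ T))
    (hGW : Integrable (fun ω => G ω * force V τ T (ω x).1) (gibbs V τ T))
    (hGx : ∀ ω r p, G (Function.update ω x (r, p)) = G (Function.update ω x (0, p))) :
    ∫ ω, G ω * partialR x f ω ∂gibbs V τ T =
      ∫ ω, G ω * force V τ T (ω x).1 * f ω ∂gibbs V τ T := by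
  have := hV.isProbabilityMeasure_siteMeasure τ hT
  have := hV.isProbabilityMeasure_tilted τ hT
  obtain ⟨C, hC⟩ := hf.bounded
  refine integral_congr_site x
    (integrable_mul_bounded hG (hf.measurable_partialR x) fun ω => ((hC ω).2 x).1)
    (integrable_mul_bounded hGW hf.measurable fun ω => (hC ω).1) fun ω h1 h2 => ?_
  rw [siteMeasure] at h1 h2 ⊢
  rw [integral_prod_symm _ h1, integral_prod_symm _ h2]
  refine integral_congr_ae (Eventually.of_forall fun p => ?_)
  simp only [partialR_update, Function.update_self]
  -- `G` does not depend on `r_x`, so it leaves the inner integral and only `f` is integrated by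
  -- parts.
  simp only [hGx ω _ p, mul_assoc, integral_const_mul]
  congr 1
  have hmeas : Measurable (deriv fun s => f (Function.update ω x (s, p))) := measurable_deriv _
  rw [hV.integral_deriv_tilted τ hT (fun r => (hf.diffR x ω p r).hasDerivAt) hmeas (C := C)
    (fun r => (hC _).1) (fun r => by rw [← partialR_update]; exact ((hC _).2 x).1)]
  simp only [mul_comm]

/-- Integration by parts in the variable `p_x`. -/
lemma integral_mul_partialP (hV : IsPotential V) (hT : 0 < T) (τ : ℝ)
    {f G : Config → ℝ} (hf : IsSmoothLocal f) (x : ℤ)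
    (hG : Integrable G (gibbs V τ T))
    (hGp : Integrable (fun ω => G ω * (ω x).2) (gibbs V τ T))
    (hGx : ∀ ω r p, G (Function.update ω x (r, p)) = G (Function.update ω x (r, 0))) :
    T * ∫ ω, G ω * partialP x f ω ∂gibbs V τ T =
      ∫ ω, G ω * (ω x).2 * f ω ∂gibbs V τ T := by
  have := hV.isProbabilityMeasure_siteMeasure τ hT
  have := hV.isProbabilityMeasure_tilted τ hT
  obtain ⟨C, hC⟩ := hf.bounded
  rw [← integral_const_mul]
  refine integral_congr_site x
    ((integrable_mul_bounded hG (hf.measurable_partialP x) fun ω => ((hC ω).2 x).2).const_mul T)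
    (integrable_mul_bounded hGp hf.measurable fun ω => (hC ω).1) fun ω h1 h2 => ?_
  rw [siteMeasure] at h1 h2 ⊢
  rw [integral_prod _ h1, integral_prod _ h2]
  refine integral_congr_ae (Eventually.of_forall fun r => ?_)
  simp only [partialP_update, Function.update_self]
  simp only [fun p => hGx ω r p, mul_assoc, integral_const_mul]
  have hmeas : Measurable (deriv fun s => f (Function.update ω x (r, s))) := measurable_deriv _
  rw [integral_deriv_gaussianReal hT (fun p => (hf.diffP x ω r p).hasDerivAt) hmeas (C := C)
    (fun p => (hC _).1) (fun p => by rw [← partialP_update]; exact ((hC _).2 x).2)]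
  simp only [mul_comm (f _)]
  field_simp

lemma memLp_momentum (hV : IsPotential V) (hT : 0 < T) (τ : ℝ) (x : ℤ) :
    MemLp (fun ω : Config => (ω x).2) 2 (gibbs V τ T) := by
  have := hV.isProbabilityMeasure_siteMeasure τ hT
  have := hV.isProbabilityMeasure_tilted τ hT
  have h1 : MemLp (fun z : ℝ × ℝ => z.2) 2 (siteMeasure V τ T) :=
    (memLp_id_gaussianReal 2).comp_measurePreserving measurePreserving_snd
  exact h1.comp_measurePreserving
    (measurePreserving_eval_infinitePi (fun _ : ℤ => siteMeasure V τ T) x)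

lemma memLp_force_site (hV : IsPotential V) (hT : 0 < T) (τ : ℝ) (x : ℤ) :
    MemLp (fun ω : Config => force V τ T (ω x).1) 2 (gibbs V τ T) := by
  have := hV.isProbabilityMeasure_siteMeasure τ hT
  have := hV.isProbabilityMeasure_tilted τ hT
  have h1 : MemLp (fun z : ℝ × ℝ => force V τ T z.1) 2 (siteMeasure V τ T) :=
    (hV.memLp_force τ hT).comp_measurePreserving measurePreserving_fst
  exact h1.comp_measurePreserving
    (measurePreserving_eval_infinitePi (fun _ : ℤ => siteMeasure V τ T) x)

lemma integrable_liouvilleAt (hV : IsPotential V) (hT : 0 < T) (τ : ℝ)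
    {f : Config → ℝ} (hf : IsSmoothLocal f) (x : ℤ) :
    Integrable (liouvilleAt V x f) (gibbs V τ T) := by
  have := hV.isProbabilityMeasure_siteMeasure τ hT
  obtain ⟨C, hC⟩ := hf.bounded
  have hp := fun x => (memLp_momentum hV hT τ x).integrable one_le_two
  have hW := fun x => (memLp_force_site hV hT τ x).integrable one_le_two
  have h1 := integrable_mul_bounded ((hp x).sub (hp (x - 1))) (hf.measurable_partialR x)
    fun ω => ((hC ω).2 x).1
  have h2 := integrable_mul_bounded (((hW (x + 1)).sub (hW x)).const_mul T)
    (hf.measurable_partialP x) fun ω => ((hC ω).2 x).2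
  refine (h1.add h2).congr (Eventually.of_forall fun ω => ?_)
  simp only [Pi.add_apply, Pi.sub_apply, liouvilleAt, force]
  field_simp
  ring

/-- With `W = (V' - τ)/T`, the difference of forces is `T (W_{x+1} - W_x)`, the tension cancelling.
Integrating by parts, `p_x ∂_{r_x}` and `T W_x ∂_{p_x}` both produce `p_x W_x f` and cancel, while
`T W_{x+1} ∂_{p_x}` becomes `p_x ∂_{r_{x+1}}`. What remains is a discrete gradient; the index `x + 1
- 1` keeps it in the form `c (x + 1) - c x`. -/
lemma integral_liouvilleAt (hV : IsPotential V) (hT : 0 < T) (τ : ℝ)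
    {f : Config → ℝ} (hf : IsSmoothLocal f) (x : ℤ) :
    ∫ ω, liouvilleAt V x f ω ∂gibbs V τ T =
      (∫ ω, (ω (x + 1 - 1)).2 * partialR (x + 1) f ω ∂gibbs V τ T) -
        ∫ ω, (ω (x - 1)).2 * partialR x f ω ∂gibbs V τ T := by
  have := hV.isProbabilityMeasure_siteMeasure τ hT
  obtain ⟨C, hC⟩ := hf.bounded
  have hp := fun x => (memLp_momentum hV hT τ x).integrable one_le_two
  have hW := fun x => (memLp_force_site hV hT τ x).integrable one_le_two
  have hpW : ∀ x y, Integrable (fun ω : Config => (ω x).2 * force V τ T (ω y).1) (gibbs V τ T) :=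
    fun x y => (memLp_momentum hV hT τ x).integrable_mul (memLp_force_site hV hT τ y)
  have hWp : ∀ x y, Integrable (fun ω : Config => force V τ T (ω y).1 * (ω x).2) (gibbs V τ T) :=
    fun x y => (memLp_force_site hV hT τ y).integrable_mul (memLp_momentum hV hT τ x)
  have i1 : ∀ y, Integrable (fun ω : Config => (ω y).2 * partialR x f ω) (gibbs V τ T) := fun y =>
    integrable_mul_bounded (hp y) (hf.measurable_partialR x) fun ω => ((hC ω).2 x).1
  have i2 : ∀ y, Integrable (fun ω : Config => force V τ T (ω y).1 * partialP x f ω)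
      (gibbs V τ T) := fun y =>
    integrable_mul_bounded (hW y) (hf.measurable_partialP x) fun ω => ((hC ω).2 x).2
  have e1 := integral_mul_partialR hV hT τ hf x (hp x) (hpW x x) (fun ω r p => by simp)
  have e2 := integral_mul_partialP hV hT τ hf x (hW x) (hWp x x) (fun ω r p => by simp)
  have e3 := integral_mul_partialP hV hT τ hf x (hW (x + 1)) (hWp x (x + 1))
    (fun ω r p => by simp)
  have e4 := integral_mul_partialR hV hT τ hf (x + 1) (hp (x + 1 - 1)) (hpW _ _)
    (fun ω r p => by simp)
  rw [add_sub_cancel_right] at e4 ⊢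
  have hsplit : ∫ ω, liouvilleAt V x f ω ∂gibbs V τ T =
      ((∫ ω, (ω x).2 * partialR x f ω ∂gibbs V τ T) -
        ∫ ω, (ω (x - 1)).2 * partialR x f ω ∂gibbs V τ T) +
      (T * (∫ ω, force V τ T (ω (x + 1)).1 * partialP x f ω ∂gibbs V τ T) -
        T * ∫ ω, force V τ T (ω x).1 * partialP x f ω ∂gibbs V τ T) := by
    have hadd := integral_add ((i1 x).sub (i1 (x - 1)))
      (((i2 (x + 1)).const_mul T).sub ((i2 x).const_mul T))
    simp only [Pi.sub_apply] at hadd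
    rw [← integral_const_mul, ← integral_const_mul, ← integral_sub (i1 x) (i1 (x - 1)),
      ← integral_sub ((i2 (x + 1)).const_mul T) ((i2 x).const_mul T), ← hadd]
    refine integral_congr_ae (Eventually.of_forall fun ω => ?_)
    simp only [liouvilleAt, force]
    field_simp
    ring
  rw [hsplit, e1, e2, e3, e4]
  simp only [mul_comm (force V τ T _)]
  ring

/-- The Gibbs measure is invariant for the Hamiltonian dynamics. -/
lemma integral_liouville (hV : IsPotential V) (hT : 0 < T) (τ : ℝ)
    {f : Config → ℝ} (hf : IsSmoothLocal f) :
    ∫ ω, liouville V f ω ∂gibbs V τ T = 0 := by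
  obtain ⟨Λ, hΛ⟩ := hf.dependsOn
  set c : ℤ → ℝ := fun x => ∫ ω, (ω (x - 1)).2 * partialR x f ω ∂gibbs V τ T with hc
  have hc0 : ∀ x, x ∉ Λ → c x = 0 := fun x hx => by
    simp only [hc, partialR_eq_zero hΛ hx, mul_zero, integral_zero]
  -- Large enough to contain the supports of both `c` and its translate `c (· + 1)`, so that the
  -- telescoping sum has no boundary term.
  set S := Λ ∪ Λ.image fun x => x - 1
  have hS : DependsOn f (S : Set ℤ) := hΛ.mono (by simp [S])
  simp_rw [liouville_eq_sum hS]
  rw [integral_finsetSum _ fun x _ => integrable_liouvilleAt hV hT τ hf x,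
    Finset.sum_congr rfl fun x _ => integral_liouvilleAt hV hT τ hf x, Finset.sum_sub_distrib,
    sub_eq_zero]
  change ∑ x ∈ S, c (x + 1) = ∑ x ∈ S, c x
  have h1 : ∑ᶠ x, c (x + 1) = ∑ x ∈ S, c (x + 1) := by
    refine finsum_eq_sum_of_support_subset _ fun x hx => ?_
    have h : x + 1 ∈ Λ := by
      by_contra h
      exact hx (hc0 _ h)
    refine Finset.mem_coe.2 (Finset.mem_union_right _ (Finset.mem_image.2 ⟨x + 1, h, by simp⟩))
  have h2 : ∑ᶠ x, c x = ∑ x ∈ S, c x := by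
    refine finsum_eq_sum_of_support_subset _ fun x hx => ?_
    refine Finset.mem_coe.2 (Finset.mem_union_left _ ?_)
    by_contra h
    exact hx (hc0 _ h)
  rw [← h1, ← h2]
  exact finsum_comp_equiv (Equiv.addRight (1 : ℤ)) (f := c)

lemma integrable_liouville (hV : IsPotential V) (hT : 0 < T) (τ : ℝ)
    {f : Config → ℝ} (hf : IsSmoothLocal f) :
    Integrable (liouville V f) (gibbs V τ T) := by
  obtain ⟨Λ, hΛ⟩ := hf.dependsOn
  rw [funext (liouville_eq_sum hΛ)]
  exact integrable_finsetSum _ fun x _ => integrable_liouvilleAt hV hT τ hf x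

/-- Antisymmetry is invariance of the measure applied to the product `f g`, by the Leibniz rule. -/
lemma integral_liouville_mul (hV : IsPotential V) (hT : 0 < T) (τ : ℝ)
    {f g : Config → ℝ} (hf : IsSmoothLocal f)
    (hg : IsSmoothLocal g) :
    ∫ ω, liouville V f ω * g ω ∂gibbs V τ T = -∫ ω, f ω * liouville V g ω ∂gibbs V τ T := by
  obtain ⟨C, hC⟩ := hf.bounded
  obtain ⟨D, hD⟩ := hg.bounded
  have h1 := integrable_mul_bounded (integrable_liouville hV hT τ hf) hg.measurable
    fun ω => (hD ω).1
  have h2 : Integrable (fun ω => f ω * liouville V g ω) (gibbs V τ T) :=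
    (integrable_mul_bounded (integrable_liouville hV hT τ hg) hf.measurable
      fun ω => (hC ω).1).congr (Eventually.of_forall fun ω => mul_comm _ _)
  have h := integral_liouville hV hT τ (hf.mul hg)
  rw [funext (liouville_mul hf hg), integral_add h1 h2] at h
  linarith

end Liouville

/-! ### Momentum reversal as an orthogonal involution of `𝓗` -/

section Reversal

variable {V : ℝ → ℝ} {τ T : ℝ} [IsProbabilityMeasure (siteMeasure V τ T)]

/-- Momentum reversal of local functions. -/
def reverseFun (f : LocalFun V τ T) : LocalFun V τ T :=
  ⟨fun ω => f (reverseMomenta ω), comp_reverseMomenta_mem f.mem⟩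

lemma reverseFun_apply (f : LocalFun V τ T) (ω : Config) :
    reverseFun f ω = f (reverseMomenta ω) := rfl

lemma reverseFun_reverseFun (f : LocalFun V τ T) : reverseFun (reverseFun f) = f :=
  Subtype.ext <| funext fun ω => congrArg f (reverseMomenta_reverseMomenta ω)

lemma integral_mul_shift_reverse (f g : LocalFun V τ T) (y : ℤ) :
    ∫ ω, f (reverseMomenta ω) * g (shift y ω) ∂gibbs V τ T =
      ∫ ω, f ω * g (reverseMomenta (shift y ω)) ∂gibbs V τ T := by
  have h := integral_comp_of_measurePreserving
    (measurePreserving_reverseMomenta (V := V) (τ := τ) (T := T))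
    (f.measurable.mul (g.measurable.comp (measurable_reverseMomenta.comp (measurable_shift y))))
  simpa [reverseMomenta_shift, reverseMomenta_reverseMomenta] using h

lemma integral_reverseFun (f : LocalFun V τ T) :
    ∫ ω, reverseFun f ω ∂gibbs V τ T = ∫ ω, f ω ∂gibbs V τ T :=
  integral_comp_of_measurePreserving measurePreserving_reverseMomenta f.measurable

lemma semiInner_reverseFun (f g : LocalFun V τ T) :
    semiInner V τ T (reverseFun f) g = semiInner V τ T f (reverseFun g) := by
  unfold semiInner
  refine tsum_congr fun y => ?_
  unfold corr
  rw [integral_reverseFun, integral_reverseFun]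
  congr 1
  exact integral_mul_shift_reverse f g y

lemma norm_reverseFun (f : LocalFun V τ T) : ‖reverseFun f‖ = ‖f‖ := by
  have h : semiInner V τ T (reverseFun f) (reverseFun f) = semiInner V τ T f f := by
    rw [semiInner_reverseFun, reverseFun_reverseFun]
  exact congrArg Real.sqrt h

/-- Momentum reversal as an isometry of the space of local functions. -/
def reverseIsometry (V : ℝ → ℝ) (τ T : ℝ) [IsProbabilityMeasure (siteMeasure V τ T)] :
    LocalFun V τ T →ₗᵢ[ℝ] LocalFun V τ T where
  toFun := reverseFun
  map_add' _ _ := rfl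
  map_smul' _ _ := rfl
  norm_map' := norm_reverseFun

/-- Momentum reversal on `𝓗`. -/
noncomputable def reversal (V : ℝ → ℝ) (τ T : ℝ) [IsProbabilityMeasure (siteMeasure V τ T)] :
    Hilb V τ T →L[ℝ] Hilb V τ T :=
  (reverseIsometry V τ T).toContinuousLinearMap.completion

lemma reversal_cls (f : LocalFun V τ T) : reversal V τ T (cls f) = cls (reverseFun f) :=
  ContinuousLinearMap.completion_apply_coe _ f

lemma reversal_reversal (u : Hilb V τ T) : reversal V τ T (reversal V τ T u) = u := by
  refine UniformSpace.Completion.induction_on u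
    (isClosed_eq (by fun_prop) (by fun_prop)) fun f => ?_
  change reversal V τ T (reversal V τ T (cls f)) = cls f
  rw [reversal_cls, reversal_cls, reverseFun_reverseFun]

lemma inner_reversal (u v : Hilb V τ T) :
    inner ℝ (reversal V τ T u) v = inner ℝ u (reversal V τ T v) := by
  refine UniformSpace.Completion.induction_on₂ u v
    (isClosed_eq (by fun_prop) (by fun_prop)) fun f g => ?_
  change inner ℝ (reversal V τ T (cls f)) (cls g) = inner ℝ (cls f) (reversal V τ T (cls g))
  rw [reversal_cls, reversal_cls, inner_cls, inner_cls, semiInner_reverseFun]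

lemma reversal_eq_neg {u : Hilb V τ T} (hu : u ∈ antisymmSpace V τ T) :
    reversal V τ T u = -u := by
  have hclosed : IsClosed {u : Hilb V τ T | reversal V τ T u = -u} :=
    isClosed_eq (by fun_prop) (by fun_prop)
  refine closure_minimal ?_ hclosed hu
  rintro _ ⟨f, hf, rfl⟩
  have h : reverseFun f = -f := Subtype.ext (funext hf)
  change reversal V τ T (cls f) = -cls f
  rw [reversal_cls, h]
  exact UniformSpace.Completion.coe_neg f

end Reversal

/-! ### Reversibility and coercivity on the core -/

section Core

variable {V : ℝ → ℝ} {τ T γ : ℝ}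

lemma integral_generator_mul (hV : IsPotential V) (hT : 0 < T) {f h : Config → ℝ}
    (hf : IsSmoothLocal f) (hh : IsSmoothLocal h) :
    ∫ ω, (liouville V f ω + γ * noise f ω) * h ω ∂gibbs V τ T =
      ∫ ω, f ω * (-liouville V h ω + γ * noise h ω) ∂gibbs V τ T := by
  have := hV.isProbabilityMeasure_siteMeasure τ hT
  obtain ⟨C, hC⟩ := hf.bounded
  obtain ⟨D, hD⟩ := hh.bounded
  have a1 := integrable_mul_bounded (integrable_liouville hV hT τ hf) hh.measurable
    fun ω => (hD ω).1
  have a2 := integrable_mul_bounded (integrable_liouville hV hT τ hh) hf.measurable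
    fun ω => (hC ω).1
  have b1 := integrable_mul_of_mem (V := V) (τ := τ) (T := T) (noise_mem hf.mem) hh.mem
  have b2 := integrable_mul_of_mem (V := V) (τ := τ) (T := T) hf.mem (noise_mem hh.mem)
  have e1 := integral_add a1 (b1.const_mul γ)
  have e2 := integral_add a2.neg (b2.const_mul γ)
  have e3 := integral_liouville_mul hV hT τ hf hh
  have e4 := integral_noise_mul (V := V) (τ := τ) (T := T) hf.mem hh.mem
  simp only [Pi.neg_apply, integral_neg, integral_const_mul] at e1 e2
  calc ∫ ω, (liouville V f ω + γ * noise f ω) * h ω ∂gibbs V τ T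
      = ∫ ω, (liouville V f ω * h ω + γ * (noise f ω * h ω)) ∂gibbs V τ T := by
        refine integral_congr_ae (Eventually.of_forall fun ω => ?_)
        simp only
        ring
    _ = ∫ ω, (-(liouville V h ω * f ω) + γ * (f ω * noise h ω)) ∂gibbs V τ T := by
        rw [e1, e2, e3, e4]
        simp only [mul_comm]
    _ = _ := by
        refine integral_congr_ae (Eventually.of_forall fun ω => ?_)
        simp only
        ring

lemma integral_generator (hV : IsPotential V) (hT : 0 < T) {f : Config → ℝ}
    (hf : IsSmoothLocal f) :
    ∫ ω, (liouville V f ω + γ * noise f ω) ∂gibbs V τ T = 0 := by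
  have := hV.isProbabilityMeasure_siteMeasure τ hT
  have hn : Integrable (noise f) (gibbs V τ T) :=
    (noise_mem hf.mem).2.2.integrable one_le_two
  rw [integral_add (integrable_liouville hV hT τ hf) (hn.const_mul γ), integral_const_mul,
    integral_liouville hV hT τ hf, integral_noise hf.mem]
  simp

/-- The `L²(μ)` adjoint `-𝔄 + γ 𝔖` is the conjugate of `𝔄 + γ 𝔖` by reversal, and both commute with
shifts. The identity therefore holds for each `y` in the sum; the products of means vanish by
stationarity. -/
lemma semiInner_generator_reverse [IsProbabilityMeasure (siteMeasure V τ T)]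
    (hV : IsPotential V) (hT : 0 < T) {f g f' g' : LocalFun V τ T} (hf : IsC01 f)
    (hg : ∀ ω, g ω = liouville V f ω + γ * noise f ω) (hf' : IsC01 f')
    (hg' : ∀ ω, g' ω = liouville V f' ω + γ * noise f' ω) :
    semiInner V τ T g (reverseFun f') = semiInner V τ T (reverseFun f) g' := by
  have hm : ∫ ω, g ω ∂gibbs V τ T = 0 := by
    simp_rw [hg]
    exact integral_generator hV hT hf.isSmoothLocal
  have hm' : ∫ ω, g' ω ∂gibbs V τ T = 0 := by
    simp_rw [hg']
    exact integral_generator hV hT hf'.isSmoothLocal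
  unfold semiInner
  refine tsum_congr fun y => ?_
  unfold corr
  rw [hm, hm', zero_mul, mul_zero]
  congr 1
  simp only [reverseFun_apply]
  rw [integral_mul_shift_reverse]
  simp_rw [hg]
  rw [integral_generator_mul hV hT hf.isSmoothLocal
    (hf'.isSmoothLocal.comp_reverseMomenta.comp_shift y)]
  refine integral_congr_ae (Eventually.of_forall fun ω => ?_)
  simp only
  rw [liouville_shift (fun ω => f' (reverseMomenta ω)), liouville_reverseMomenta,
    noise_shift (fun ω => f' (reverseMomenta ω)), noise_reverseMomenta, hg', neg_neg]

/-- Translation invariance turns a Toeplitz double sum of correlations into one integral of a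
product of block sums, to which `L²(μ)` inequalities apply. -/
lemma sum_integral_mul_shift [IsProbabilityMeasure (siteMeasure V τ T)] {f k : Config → ℝ}
    (hf : f ∈ localSubmodule V τ T) (hk : k ∈ localSubmodule V τ T) (n : ℕ) :
    ∑ a ∈ Finset.range n, ∑ b ∈ Finset.range n,
        ∫ ω, f ω * k (shift ((b : ℤ) - a) ω) ∂gibbs V τ T =
      ∫ ω, (∑ a ∈ Finset.range n, f (shift a ω)) * (∑ b ∈ Finset.range n, k (shift b ω))
        ∂gibbs V τ T := by
  simp_rw [Finset.sum_mul_sum]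
  have hint : ∀ a b : ℕ, Integrable (fun ω => f (shift a ω) * k (shift b ω)) (gibbs V τ T) :=
    fun a b => integrable_mul_of_mem (comp_shift_mem hf a) (comp_shift_mem hk b)
  rw [integral_finsetSum _ fun a _ => integrable_finsetSum _ fun b _ => hint a b]
  refine Finset.sum_congr rfl fun a _ => ?_
  rw [integral_finsetSum _ fun b _ => hint a b]
  refine Finset.sum_congr rfl fun b _ => ?_
  rw [← integral_comp_shift (fun ω => f ω * k (shift ((b : ℤ) - a) ω))
    (hf.1.mul (hk.1.comp (measurable_shift _))) a]
  simp [shift_shift]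

/-- The spectral gap of the noise in `L²(μ)` applied to the block sum `F`; noise and reversal both
commute with shifts. -/
lemma sum_noise_form_nonneg [IsProbabilityMeasure (siteMeasure V τ T)] {f : Config → ℝ}
    (hf : f ∈ localSubmodule V τ T) (n : ℕ) :
    0 ≤ ∑ a ∈ Finset.range n, ∑ b ∈ Finset.range n,
      ((∫ ω, f ω * f (reverseMomenta (shift ((b : ℤ) - a) ω)) ∂gibbs V τ T) -
        (∫ ω, f ω * f (shift ((b : ℤ) - a) ω) ∂gibbs V τ T) -
        ∫ ω, f ω * noise f (shift ((b : ℤ) - a) ω) ∂gibbs V τ T) := by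
  set F : Config → ℝ := fun ω => ∑ a ∈ Finset.range n, f (shift a ω) with hF
  have hFmem : F ∈ localSubmodule V τ T := by
    have h : F = ∑ a ∈ Finset.range n, fun ω => f (shift a ω) := by
      funext ω
      rw [Finset.sum_apply]
    rw [h]
    exact Submodule.sum_mem _ fun a _ => comp_shift_mem hf a
  have hnoise : ∀ ω, ∑ b ∈ Finset.range n, noise f (shift b ω) = noise F ω := fun ω => by
    rw [hF, noise_sum _ fun a : ℕ => (comp_shift_mem hf a).2.1]
    exact Finset.sum_congr rfl fun a _ => (noise_shift f a ω).symm
  simp only [Finset.sum_sub_distrib]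
  rw [sum_integral_mul_shift hf (comp_reverseMomenta_mem hf), sum_integral_mul_shift hf hf,
    sum_integral_mul_shift hf (noise_mem hf)]
  simp only [hnoise]
  have := integral_mul_noise_le hFmem
  simp only [hF, ← reverseMomenta_shift] at this ⊢
  linarith

lemma semiInner_generator_le [IsProbabilityMeasure (siteMeasure V τ T)]
    (hV : IsPotential V) (hT : 0 < T) (hγ : 0 < γ) {f g : LocalFun V τ T} (hf : IsC01 f)
    (hg : ∀ ω, g ω = liouville V f ω + γ * noise f ω) :
    semiInner V τ T f g ≤ -(γ * (semiInner V τ T f f - semiInner V τ T f (reverseFun f))) := by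
  have hs := hf.isSmoothLocal
  have hm : ∫ ω, g ω ∂gibbs V τ T = 0 := by
    simp_rw [hg]
    exact integral_generator hV hT hs
  -- Symmetrizing the correlation removes the Liouville part, which is antisymmetric and commutes
  -- with shifts, and doubles the noise part.
  have hnoise : ∀ y, corr V τ T f g y + corr V τ T g f y =
      2 * γ * ∫ ω, f ω * noise f (shift y ω) ∂gibbs V τ T := by
    intro y
    have i1 := integrable_mul_of_mem f.mem (comp_shift_mem (noise_mem f.mem) y)
    have i2 := integrable_mul_of_mem f.mem (comp_shift_mem g.mem y)
    have e1 : ∫ ω, g ω * f (shift y ω) ∂gibbs V τ T =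
        2 * γ * (∫ ω, f ω * noise f (shift y ω) ∂gibbs V τ T) -
          ∫ ω, f ω * g (shift y ω) ∂gibbs V τ T := by
      rw [← integral_const_mul, ← integral_sub (i1.const_mul _) i2]
      have h := integral_generator_mul (γ := γ) (τ := τ) hV hT hs (hs.comp_shift y)
      simp only [← hg] at h
      rw [h]
      refine integral_congr_ae (Eventually.of_forall fun ω => ?_)
      simp only
      rw [liouville_shift, noise_shift, hg]
      ring
    unfold corr
    rw [hm, e1]
    ring
  -- The total of `C` is twice the defect in the claimed inequality, and its Toeplitz sums are
  -- nonnegative multiples of the forms in `sum_noise_form_nonneg`.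
  set C : ℤ → ℝ := fun y => (-corr V τ T f g y - corr V τ T g f y) -
    2 * γ * (corr V τ T f f y - corr V τ T f (reverseFun f) y) with hC
  have hCeq : ∀ y, C y = 2 * γ * ((∫ ω, f ω * f (reverseMomenta (shift y ω)) ∂gibbs V τ T) -
      (∫ ω, f ω * f (shift y ω) ∂gibbs V τ T) -
      ∫ ω, f ω * noise f (shift y ω) ∂gibbs V τ T) := by
    intro y
    have e1 : corr V τ T f f y - corr V τ T f (reverseFun f) y =
        (∫ ω, f ω * f (shift y ω) ∂gibbs V τ T) -
          ∫ ω, f ω * f (reverseMomenta (shift y ω)) ∂gibbs V τ T := by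
      unfold corr
      rw [integral_reverseFun]
      simp only [reverseFun_apply]
      ring
    simp only [hC]
    rw [e1]
    linear_combination -hnoise y
  obtain ⟨R₁, h₁⟩ := exists_corr_eq_zero f g
  obtain ⟨R₂, h₂⟩ := exists_corr_eq_zero g f
  obtain ⟨R₃, h₃⟩ := exists_corr_eq_zero f f
  obtain ⟨R₄, h₄⟩ := exists_corr_eq_zero f (reverseFun f)
  have hnonneg : 0 ≤ ∑' y, C y := by
    refine tsum_nonneg_of_forms C (R₁ + R₂ + R₃ + R₄) (fun y hy => ?_) fun n => ?_
    · push_cast at hy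
      simp only [hC]
      rw [h₁ y (by omega), h₂ y (by omega), h₃ y (by omega), h₄ y (by omega)]
      simp
    · simp only [hCeq, ← Finset.mul_sum]
      exact mul_nonneg (by positivity) (sum_noise_form_nonneg f.mem n)
  have htsum : ∑' y, C y = (-semiInner V τ T f g - semiInner V τ T g f) -
      2 * γ * (semiInner V τ T f f - semiInner V τ T f (reverseFun f)) :=
    (((summable_corr f g).hasSum.neg.sub (summable_corr g f).hasSum).sub
      (((summable_corr f f).hasSum.sub
        (summable_corr f (reverseFun f)).hasSum).mul_left (2 * γ))).tsum_eq
  rw [htsum, semiInner_comm g f] at hnonneg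
  linarith

end Core

/-! ### From the core to the domain of the generator -/

section Generator

variable {V : ℝ → ℝ} {τ T γ : ℝ}

/-- The infinite volume generator is reversible up to momentum reversal, and coercive on functions
antisymmetric in the momenta. -/
theorem IsChainGenerator.isReversible [IsProbabilityMeasure (siteMeasure V τ T)]
    (hV : IsPotential V) (hT : 0 < T) (hγ : 0 < γ) {L : Hilb V τ T →ₗ.[ℝ] Hilb V τ T}
    (hL : IsChainGenerator V τ T γ L) : IsReversible L (reversal V τ T) γ where
  pos := hγ
  invol := reversal_reversal
  symm := inner_reversal
  coercive u v huv := by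
    -- The inequality is a closed condition on pairs `(u, L u)`, and the core is dense in the graph.
    have hclosed : IsClosed {z : Hilb V τ T × Hilb V τ T |
        inner ℝ z.1 z.2 ≤ -(γ * (‖z.1‖ ^ 2 - inner ℝ z.1 (reversal V τ T z.1)))} :=
      isClosed_le (by fun_prop) (by fun_prop)
    refine closure_minimal ?_ hclosed (hL.core huv)
    rintro _ ⟨f, g, hf, hg, rfl⟩
    change inner ℝ (cls f) (cls g) ≤
      -(γ * (‖cls f‖ ^ 2 - inner ℝ (cls f) (reversal V τ T (cls f))))
    rw [← real_inner_self_eq_norm_sq, reversal_cls, inner_cls, inner_cls, inner_cls]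
    exact semiInner_generator_le hV hT hγ hf hg
  reversal u v u' v' huv huv' := by
    have hclosed : ∀ w : Hilb V τ T × Hilb V τ T, IsClosed {z : Hilb V τ T × Hilb V τ T |
        inner ℝ z.2 (reversal V τ T w.1) = inner ℝ (reversal V τ T z.1) w.2} := fun w =>
      isClosed_eq (by fun_prop) (by fun_prop)
    have hclosed' : ∀ z : Hilb V τ T × Hilb V τ T, IsClosed {w : Hilb V τ T × Hilb V τ T |
        inner ℝ z.2 (reversal V τ T w.1) = inner ℝ (reversal V τ T z.1) w.2} := fun z =>
      isClosed_eq (by fun_prop) (by fun_prop)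
    -- The bilinear identity is extended from the core one argument at a time.
    refine closure_minimal (fun z hz => ?_) (hclosed (u', v')) (hL.core huv)
    refine closure_minimal (fun w hw => ?_) (hclosed' z) (hL.core huv')
    obtain ⟨f, g, hf, hg, rfl⟩ := hz
    obtain ⟨f', g', hf', hg', rfl⟩ := hw
    change inner ℝ (cls g) (reversal V τ T (cls f')) = inner ℝ (reversal V τ T (cls f)) (cls g')
    rw [reversal_cls, reversal_cls, inner_cls, inner_cls]
    exact semiInner_generator_reverse hV hT hf hg hf' hg'

end Generator

end FlipChain
open FlipChain
theorem theorem5p1 (V : ℝ → ℝ) (hV : IsPotential V) (τ T γ : ℝ) (hT : 0 < T) (hγ : 0 < γ)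
    (L : Hilb V τ T →ₗ.[ℝ] Hilb V τ T) (hL : IsChainGenerator V τ T γ L) :
    (∀ s : ℝ, 0 < s →
      Function.Bijective fun u : L.domain => s • (u : Hilb V τ T) - L u) ∧
    ∃ σ : Hilb V τ T → Hilb V τ T → ℝ,
      (∀ f ∈ antisymmSpace V τ T, ∀ g ∈ antisymmSpace V τ T,
        Tendsto (fun s : ℝ => inner ℝ f (resolventApply L s g)) (𝓝[>] 0) (𝓝 (σ f g))) ∧
      ∀ f ∈ antisymmSpace V τ T, ∀ g ∈ antisymmSpace V τ T, σ f g = σ g f := by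
  have := hV.isProbabilityMeasure_siteMeasure τ hT
  have hrev := hL.isReversible hV hT hγ
  have hbij : ∀ s : ℝ, 0 < s →
      Function.Bijective fun u : L.domain => s • (u : Hilb V τ T) - L u := fun s hs =>
    hL.generates.bijective (fun u v huv => hrev.dissipative huv) hs
  exact ⟨hbij, hrev.exists_symmetric_limit hbij fun f hf => reversal_eq_neg hf⟩
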